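/- **Theorem (Efficient unitary $t$-design).** For every constant $K_0$ there is a constant $K>0$, depending only on $K_0$, such that the following holds for all integers $n,t\ge 0$, with $d=2^n$ and $[d]$ identified with $\{0,1\}^n$. Let $\mathcal F$ be a probability distribution on functions $f:[d]\to\{0,1\}$ (for instance, the uniform distribution on a finite function family) that is $2t$-wise independent: for all distinct $x_1,\dots,x_{2t}\in[d]$ and all $y_1,\dots,y_{2t}\in\{0,1\}$, $$\Pr_{f\sim\mathcal F}[f(x_1)=y_1\wedge\dots\wedge f(x_{2t})=y_{2t}]=2^{-2t}.$$ Let $\mathcal D$ be a probability distribution on permutations of $[d]$ that is $\delta$-approximate $t$-wise independent: for all distinct $x_1,\dots,x_t\in[d]$ and all distinct $y_1,\dots,y_t\in[d]$, $$\Bigl|\Pr_{\pi\sim\mathcal D}[\pi(x_1)=y_1\wedge\dots\wedge\pi(x_t)=y_t]-\frac1{d(d-1)\cdots(d-t+1)}\Bigr|\le\delta,\qquad\text{where }\ \delta\le K_0\,\frac{t}{d^{4t+1/2}}.$$ Let $\nu$ be the law of the random unitary $U=P_\pi F_f C\in\mathrm U(d)$, where $\pi\sim\mathcal D$, $f\sim\mathcal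 F$ and a uniformly random element $C$ of the $n$-qubit Clifford group (the normalizer of the $n$-qubit Pauli group in $\mathrm U(d)$, with its Haar probability measure; global phases are immaterial) are independent, $P_\pi|x\rangle=|\pi(x)\rangle$ and $F_f|x\rangle=(-1)^{f(x)}|x\rangle$. Then $\nu$ is a diamond $\epsilon$-approximate $t$-design with $\epsilon=K\,t/\sqrt d$, that is, $$\bigl\|\mathcal M^{(t)}_\nu-\mathcal M^{(t)}_{\mathrm{Haar}}\bigr\|_\Diamond\le K\,\frac{t}{\sqrt d},$$ where $\mathcal M^{(t)}_\mu(A)=\mathbb E_{R\sim\mu}\,R^{\otimes t}A\,(R^{\otimes t})^\dagger$ for $A\in\mathrm L(\mathcal H)$, $\mathcal H=(\mathbb C^d)^{\otimes t}$, Haar denotes the Haar probability measure on $\mathrm U(d)$, and $\|\mathcal M-\mathcal N\|_\Diamond=\max_{\psi}\|(\mathcal M\otimes\mathrm{id}_{\mathcal H})(|\psi\rangle\langle\psi|)-(\mathcal N\otimes\mathrm{id}_{\mathcal H})(|\psi\rangle\langle\psi|)\|_1$, the maximum being over unit vectors $\psi\in\mathcal H\otimes\mathcal H$ and $\|\cdot\|_1$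 being the trace norm. -/

import Mathlib

open MeasureTheory
open scoped Matrix ENNReal

noncomputable section

/-! ### Probability: Haar measure and `t`-wise independence -/

/-- The Haar probability measure of a compact topological group. -/
def haarProb (G : Type*) [Group G] [TopologicalSpace G] [IsTopologicalGroup G] [CompactSpace G]
    [MeasurableSpace G] [BorelSpace G] : Measure G :=
  Measure.haarMeasure ⊤

/-- A distribution over functions `α → β` is `t`-wise independent if its values at any `t` distinct
points are independent and uniform: `Pr[f(x₁) = y₁ ∧ … ∧ f(x_t) = y_t] = |β|^{-t}`. -/
def IsTWiseIndependent {α β : Type*} [Fintype β] (t : ℕ) (F : PMF (α → β)) : Prop :=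
  ∀ (x : Fin t → α) (y : Fin t → β), Function.Injective x →
    (F.toOuterMeasure {f | ∀ i, f (x i) = y i}).toReal = ((Fintype.card β : ℝ) ^ t)⁻¹

/-- A distribution over permutations of `α`, `N = |α|`, is `δ`-approximate `t`-wise independent if
for all distinct `x₁, …, x_t` and all distinct `y₁, …, y_t` the probability of
`π(x₁) = y₁ ∧ … ∧ π(x_t) = y_t` is within `δ` of `1 / (N (N-1) ⋯ (N-t+1))`. -/
def IsApproxTWiseIndependentPerm {α : Type*} [Fintype α] (t : ℕ) (δ : ℝ)
    (D : PMF (Equiv.Perm α)) : Prop :=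
  ∀ x y : Fin t → α, Function.Injective x → Function.Injective y →
    |(D.toOuterMeasure {π | ∀ i, π (x i) = y i}).toReal
      - (((Fintype.card α).descFactorial t : ℕ) : ℝ)⁻¹| ≤ δ

/-! ### The unitary group as a compact group with its Borel sets -/

section Unitary

variable {ι : Type*} [Fintype ι] [DecidableEq ι]

instance instCompactSpaceUnitaryGroup : CompactSpace (Matrix.unitaryGroup ι ℂ) := by
  have hK : IsCompact (Set.univ.pi fun _ : ι => Set.univ.pi fun _ : ι =>
      Metric.closedBall (0 : ℂ) 1) :=
    isCompact_univ_pi fun _ => isCompact_univ_pi fun _ => isCompact_closedBall _ _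
  have hc : IsClosed ((Matrix.unitaryGroup ι ℂ : Set (Matrix ι ι ℂ))) := isClosed_unitary
  refine isCompact_iff_compactSpace.mp (IsCompact.of_isClosed_subset (X := Matrix ι ι ℂ) hK hc ?_)
  intro U hU i _ j _
  simpa using entry_norm_bound_of_unitary hU i j

instance instMeasurableSpaceUnitaryGroup : MeasurableSpace (Matrix.unitaryGroup ι ℂ) :=
  borel _

instance instBorelSpaceUnitaryGroup : BorelSpace (Matrix.unitaryGroup ι ℂ) :=
  ⟨rfl⟩

/-- The permutation operator `P_π : |x⟩ ↦ |π(x)⟩`. -/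
def permOp (π : Equiv.Perm ι) : Matrix.unitaryGroup ι ℂ :=
  ⟨Matrix.of fun y x => if y = π x then 1 else 0, by
    rw [Matrix.mem_unitaryGroup_iff']
    ext x y
    simp [Matrix.mul_apply, Matrix.star_apply, Matrix.one_apply, eq_comm]⟩

/-- The binary phase operator `F_f : |x⟩ ↦ (-1)^{f(x)} |x⟩`. -/
def phaseOp (f : ι → ZMod 2) : Matrix.unitaryGroup ι ℂ :=
  ⟨Matrix.diagonal fun x => (-1) ^ (f x).val, by
    rw [Matrix.mem_unitaryGroup_iff', Matrix.star_eq_conjTranspose, Matrix.diagonal_conjTranspose,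
      Matrix.diagonal_mul_diagonal, ← Matrix.diagonal_one]
    congr 1
    funext x
    simp [← mul_pow]⟩

end Unitary

/-! ### The `n`-qubit Pauli and Clifford groups -/

/-- Bit strings of length `n`; they index the computational basis of `n` qubits, of dimension
`d = 2 ^ n`. -/
abbrev Bits (n : ℕ) : Type := Fin n → ZMod 2

/-- The matrix `X^a Z^b = ⨂ᵢ X^{aᵢ} Z^{bᵢ}`, that is `|x⟩ ↦ (-1)^{b·x} |x + a⟩`. -/
def pauliMatrix {n : ℕ} (a b : Bits n) : Matrix (Bits n) (Bits n) ℂ :=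
  Matrix.of fun y x => if y = x + a then (-1) ^ (b ⬝ᵥ x).val else 0

theorem neg_one_pow_val_add (u v : ZMod 2) :
    (-1 : ℂ) ^ (u + v).val = (-1) ^ u.val * (-1) ^ v.val := by
  have h : ∀ u v : ZMod 2, (u + v).val % 2 = (u.val + v.val) % 2 := by decide
  rw [← pow_add, neg_one_pow_eq_pow_mod_two, h, ← neg_one_pow_eq_pow_mod_two]

theorem bits_add_self {n : ℕ} (a : Bits n) : a + a = 0 :=
  funext fun i => CharTwo.add_self_eq_zero (a i)

theorem pauliMatrix_mul {n : ℕ} (a b c e : Bits n) :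
    pauliMatrix a b * pauliMatrix c e =
      ((-1 : ℂ) ^ (b ⬝ᵥ c).val) • pauliMatrix (a + c) (b + e) := by
  ext y x
  simp only [pauliMatrix, Matrix.mul_apply, Matrix.of_apply, Matrix.smul_apply, smul_eq_mul]
  rw [Finset.sum_eq_single (x + c) (fun z _ hz => by rw [if_neg hz, mul_zero]) (by simp)]
  rw [if_pos rfl, add_right_comm, ← add_assoc]
  by_cases h : y = x + a + c
  · simp only [h, if_true, dotProduct_add, add_dotProduct, neg_one_pow_val_add]
    ring
  · simp [h]

theorem pauliMatrix_zero {n : ℕ} : pauliMatrix (0 : Bits n) 0 = 1 := by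
  ext y x
  simp [pauliMatrix, Matrix.one_apply]

/-- The `n`-qubit Pauli group: the unitaries `i^k X^a Z^b`, equivalently all `n`-fold tensor
products of `I, X, Y, Z` with phases `±1, ±i`. -/
def pauliGroup (n : ℕ) : Subgroup (Matrix.unitaryGroup (Bits n) ℂ) where
  carrier := {U | ∃ (k : ℕ) (a b : Bits n),
    (U : Matrix (Bits n) (Bits n) ℂ) = (Complex.I ^ k) • pauliMatrix a b}
  one_mem' := ⟨0, 0, 0, by simp [pauliMatrix_zero]⟩
  mul_mem' := by
    rintro U V ⟨k, a, b, hU⟩ ⟨l, c, e, hV⟩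
    refine ⟨k + l + 2 * (b ⬝ᵥ c).val, a + c, b + e, ?_⟩
    rw [Matrix.UnitaryGroup.mul_val, hU, hV, Matrix.smul_mul, Matrix.mul_smul, pauliMatrix_mul,
      smul_smul, smul_smul, pow_add, pow_add, pow_mul, Complex.I_sq]
  inv_mem' := by
    rintro U ⟨k, a, b, hU⟩
    refine ⟨3 * k + 2 * (b ⬝ᵥ a).val, a, b, ?_⟩
    have h : (U : Matrix (Bits n) (Bits n) ℂ) *
        ((Complex.I ^ (3 * k + 2 * (b ⬝ᵥ a).val)) • pauliMatrix a b) = 1 := by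
      rw [hU, Matrix.smul_mul, Matrix.mul_smul, pauliMatrix_mul, smul_smul, smul_smul,
        bits_add_self, bits_add_self, pauliMatrix_zero, pow_add, pow_mul Complex.I 2,
        Complex.I_sq, ← mul_assoc, ← pow_add, mul_assoc, ← mul_pow,
        show k + 3 * k = 4 * k by ring, pow_mul, Complex.I_pow_four]
      simp
    have h2 : ((U⁻¹ : Matrix.unitaryGroup (Bits n) ℂ) : Matrix (Bits n) (Bits n) ℂ) *
        (U : Matrix (Bits n) (Bits n) ℂ) = 1 := by
      rw [← Matrix.UnitaryGroup.mul_val, inv_mul_cancel, Matrix.UnitaryGroup.one_val]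
    exact left_inv_eq_right_inv h2 h

theorem finite_pauliGroup (n : ℕ) : (pauliGroup n : Set (Matrix.unitaryGroup (Bits n) ℂ)).Finite := by
  have hfin : (Set.range fun p : Fin 4 × Bits n × Bits n =>
      (Complex.I ^ (p.1 : ℕ)) • pauliMatrix p.2.1 p.2.2).Finite := Set.finite_range _
  refine (hfin.preimage (f := Subtype.val) Subtype.val_injective.injOn).subset ?_
  rintro U ⟨k, a, b, hU⟩
  refine ⟨(⟨k % 4, Nat.mod_lt _ (by norm_num)⟩, a, b), ?_⟩
  change (Complex.I ^ (k % 4)) • pauliMatrix a b = _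
  rw [hU, ← Complex.I_pow_eq_pow_mod]

/-- The `n`-qubit Clifford group: the normalizer of the Pauli group in the unitary group. -/
def cliffordGroup (n : ℕ) : Subgroup (Matrix.unitaryGroup (Bits n) ℂ) :=
  Subgroup.normalizer (pauliGroup n : Set (Matrix.unitaryGroup (Bits n) ℂ))

theorem isClosed_normalizer_of_finite {G : Type*} [Group G] [TopologicalSpace G]
    [IsTopologicalGroup G] [T1Space G] (H : Subgroup G) (hH : (H : Set G).Finite) :
    IsClosed (Subgroup.normalizer (H : Set G) : Set G) := by
  have h : (Subgroup.normalizer (H : Set G) : Set G) =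
      ⋂ p ∈ H, {g : G | g * p * g⁻¹ ∈ (H : Set G)} ∩ {g : G | g⁻¹ * p * g ∈ (H : Set G)} := by
    ext g
    simp only [SetLike.mem_coe, Subgroup.mem_normalizer_iff, Set.mem_iInter, Set.mem_inter_iff,
      Set.mem_ofPred_eq]
    refine ⟨fun hg p hp => ⟨(hg p).1 hp, (hg _).2 ?_⟩,
      fun hg p => ⟨fun hp => (hg p hp).1, fun hp => ?_⟩⟩
    · simpa [mul_assoc] using hp
    · simpa [mul_assoc] using (hg _ hp).2
  rw [h]
  exact isClosed_biInter fun p _ => IsClosed.inter (hH.isClosed.preimage (by fun_prop))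
    (hH.isClosed.preimage (by fun_prop))

theorem isClosed_cliffordGroup (n : ℕ) :
    IsClosed (cliffordGroup n : Set (Matrix.unitaryGroup (Bits n) ℂ)) :=
  isClosed_normalizer_of_finite _ (finite_pauliGroup n)

instance instCompactSpaceCliffordGroup (n : ℕ) : CompactSpace (cliffordGroup n) :=
  isCompact_iff_compactSpace.mp (isClosed_cliffordGroup n).isCompact

/-! ### Twirls, diamond distance and designs -/

section Designs

variable {ι κ : Type*} [Fintype ι] [DecidableEq ι] [Fintype κ] [DecidableEq κ]

/-- The tensor power `U^{⊗ t}`, a matrix indexed by `t`-tuples of basis labels. -/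
def tensorPow (t : ℕ) (U : Matrix ι ι ℂ) : Matrix (Fin t → ι) (Fin t → ι) ℂ :=
  Matrix.of fun x y => ∏ i, U (x i) (y i)

/-- The `t`-wise twirl `A ↦ 𝔼_{R ∼ ν} R^{⊗ t} A (R^{⊗ t})†`; the expectation of the random matrix is
taken entry by entry. -/
def twirl (ν : Measure (Matrix.unitaryGroup ι ℂ)) (t : ℕ) (A : Matrix (Fin t → ι) (Fin t → ι) ℂ) :
    Matrix (Fin t → ι) (Fin t → ι) ℂ :=
  Matrix.of fun x y => ∫ R, (tensorPow t (R : Matrix ι ι ℂ) * A *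
    (tensorPow t (R : Matrix ι ι ℂ))ᴴ) x y ∂ν

/-- The trace norm `‖A‖₁ = Tr √(A† A)`, the sum of the square roots of the eigenvalues of
`A† A`. -/
def traceNorm (A : Matrix κ κ ℂ) : ℝ :=
  ∑ i, √((Matrix.isHermitian_conjTranspose_mul_self A).eigenvalues i)

/-- `M ⊗ id` for a map `M` on matrices indexed by `κ`: it applies `M` to each block of a matrix
on the tensor product with a second register indexed by `η`. -/
def extendById {η : Type*} (M : Matrix κ κ ℂ → Matrix κ κ ℂ) (O : Matrix (κ × η) (κ × η) ℂ) :
    Matrix (κ × η) (κ × η) ℂ :=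
  Matrix.of fun p q => M (Matrix.of fun a b => O (a, p.2) (b, q.2)) p.1 q.1

/-- The projector `|ψ⟩⟨ψ|`. -/
def proj (ψ : EuclideanSpace ℂ κ) : Matrix κ κ ℂ :=
  Matrix.of fun x y => ψ x * star (ψ y)

/-- The diamond distance: the supremum over unit vectors `ψ` of `H ⊗ H` of
`‖(M ⊗ id)(|ψ⟩⟨ψ|) - (N ⊗ id)(|ψ⟩⟨ψ|)‖₁`. -/
def diamondDist (M N : Matrix κ κ ℂ → Matrix κ κ ℂ) : ℝ≥0∞ :=
  ⨆ (ψ : EuclideanSpace ℂ (κ × κ)) (_ : ‖ψ‖ = 1),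
    ENNReal.ofReal (traceNorm (extendById M (proj ψ) - extendById N (proj ψ)))

/-- `ν` is a diamond `ε`-approximate `t`-design. -/
def IsDiamondApproxDesign (ν : Measure (Matrix.unitaryGroup ι ℂ)) (t : ℕ) (ε : ℝ) : Prop :=
  diamondDist (twirl ν t) (twirl (haarProb (Matrix.unitaryGroup ι ℂ)) t) ≤ ENNReal.ofReal ε

end Designs

/-- The law of `P_π F_f C`, for `π ∼ D`, `f ∼ F` and a uniformly (Haar) random element `C` of the
`n`-qubit Clifford group, drawn independently. -/
def pfcEnsemble (n : ℕ) (D : PMF (Equiv.Perm (Bits n))) (F : PMF (Bits n → ZMod 2)) :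
    Measure (Matrix.unitaryGroup (Bits n) ℂ) :=
  ∑ π, ∑ f, (D π * F f) •
    Measure.map (fun C : cliffordGroup n => permOp π * phaseOp f * (C : Matrix.unitaryGroup (Bits n) ℂ))
      (haarProb (cliffordGroup n))

end

/-! By trace-norm duality it suffices to fix a unit vector `ψ` and a contraction `W` and to compare
the averages of `⟨Rψ, W Rψ⟩` over the two ensembles, where `R` acts as `R^{⊗t} ⊗ id`. Write `R = P_π
F_f U`. In the first ensemble `U` is a random Clifford. Haar measure absorbs left factors, so the
Haar average has the same form with `U` Haar distributed and the same laws of `π` and `f`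
(`integral_haarProb_eq_integral_pfMean`). Hence it is enough to show, for either law of `U`, that
averaging over `π` and `f` brings the form close to one number independent of `U`.

That number is `meanForm W ψ`. On vectors supported on tuples of distinct labels, the `2t`-wise
independent phase kills all pairs `(x, y)` except rearrangements `y = x ∘ σ`, and the permutation
then replaces `x` by a nearly uniform distinct tuple `x'`. With exact uniformity this gives a form
that makes sense for all vectors and sees only the correlations of the vector with its permuted
copies. These are unchanged by `U^{⊗t}` (`meanForm_tensorAct`), which removes `U`.

The price is the part of `Uψ` on tuples with a repeated label. Its squared norm enters linearly
through `norm_meanForm_le` and through its square root through `norm_sesq_self_sub_le`. Its mean is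
at most `2 t² / d`: for each pair of positions, `integral_collisionWeight_le` gives at most `2 / d`.
Only left invariance under the Clifford unitaries `H^{⊗n}` times quadratic diagonal phases is used
for this: the phases separate unordered pairs of bit strings, and the Hadamard entries all have
modulus `1 / √d`. The total error is therefore of order `t / √d`. -/

noncomputable section

/-! ### Trace-norm duality and quadratic forms of contractions. -/

section Contraction

variable {α : Type*} [Fintype α]

/-- The squared `ℓ²` norm of a finite complex vector. -/
def l2sq (u : α → ℂ) : ℝ := ∑ p, ‖u p‖ ^ 2

/-- The sesquilinear form `⟨u, W v⟩`. -/
def sesq (W : Matrix α α ℂ) (u v : α → ℂ) : ℂ := ∑ p, ∑ q, star (u p) * W p q * v q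

/-- `W` has operator norm at most one. -/
def IsContraction (W : Matrix α α ℂ) : Prop :=
  ∀ u v : α → ℂ, ‖sesq W u v‖ ≤ √(l2sq u) * √(l2sq v)

theorem l2sq_nonneg (u : α → ℂ) : 0 ≤ l2sq u := Finset.sum_nonneg fun _ _ => sq_nonneg _

theorem l2sq_eq_star_dotProduct (u : α → ℂ) : (l2sq u : ℂ) = star u ⬝ᵥ u := by
  simp only [l2sq, dotProduct, Pi.star_apply, Complex.ofReal_sum]
  refine Finset.sum_congr rfl fun p _ => ?_
  rw [Complex.star_def, ← Complex.normSq_eq_conj_mul_self, Complex.normSq_eq_norm_sq]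

theorem sesq_eq_dotProduct (W : Matrix α α ℂ) (u v : α → ℂ) :
    sesq W u v = star u ⬝ᵥ (W *ᵥ v) := by
  simp only [sesq, dotProduct, Matrix.mulVec, Finset.mul_sum, Pi.star_apply, mul_assoc]

theorem sum_mul_le_sqrt_l2sq (u v : α → ℂ) :
    ∑ p, ‖u p‖ * ‖v p‖ ≤ √(l2sq u) * √(l2sq v) :=
  Real.sum_mul_le_sqrt_mul_sqrt _ _ _

theorem norm_star_dotProduct_le (u v : α → ℂ) : ‖star u ⬝ᵥ v‖ ≤ √(l2sq u) * √(l2sq v) := by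
  refine le_trans (norm_sum_le _ _) (le_trans (le_of_eq ?_) (sum_mul_le_sqrt_l2sq u v))
  simp

theorem l2sq_mulVec [DecidableEq α] {V : Matrix α α ℂ} (hV : Vᴴ * V = 1) (u : α → ℂ) :
    l2sq (V *ᵥ u) = l2sq u := by
  have h : (l2sq (V *ᵥ u) : ℂ) = l2sq u := by
    rw [l2sq_eq_star_dotProduct, l2sq_eq_star_dotProduct, Matrix.star_mulVec,
      ← Matrix.dotProduct_mulVec, Matrix.mulVec_mulVec, hV, Matrix.one_mulVec]
  exact_mod_cast h

-- `W` is the adjoint of the partial isometry in the polar decomposition of `A`, so that `W A = √(A†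
-- A)`.
open scoped ComplexOrder in
theorem exists_contraction_trace_eq_traceNorm [DecidableEq α] (A : Matrix α α ℂ) :
    ∃ W : Matrix α α ℂ, IsContraction W ∧ (traceNorm A : ℂ) = (W * A).trace := by
  set hA := Matrix.isHermitian_conjTranspose_mul_self A with hhA
  set V : Matrix α α ℂ := (hA.eigenvectorUnitary : Matrix α α ℂ) with hV
  have hV1 : Vᴴ * V = 1 := by
    have := Unitary.coe_star_mul_self hA.eigenvectorUnitary
    rwa [Matrix.star_eq_conjTranspose] at this
  have hV2 : V * Vᴴ = 1 := mul_eq_one_comm.mp hV1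
  set l := hA.eigenvalues with hl
  have hl0 : ∀ i, 0 ≤ l i := fun i =>
    (Matrix.posSemidef_conjTranspose_mul_self A).eigenvalues_nonneg i
  have hspec : Aᴴ * A = V * Matrix.diagonal (fun i => (l i : ℂ)) * Vᴴ := by
    have := hA.spectral_theorem
    rw [Unitary.conjStarAlgAut_apply] at this
    rw [← Matrix.star_eq_conjTranspose V]
    exact this
  -- Since `0⁻¹ = 0`, this is the pseudo-inverse of `√(A† A)` in its eigenbasis, and no
  -- invertibility is needed.
  set S : Matrix α α ℂ := Matrix.diagonal (fun i => ((√(l i))⁻¹ : ℂ)) with hS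
  have hSH : Sᴴ = S := by
    rw [hS, Matrix.diagonal_conjTranspose]
    congr 1
    funext i
    simp
  have hkey : Aᴴ * A * V = V * Matrix.diagonal (fun i => (l i : ℂ)) := by
    rw [hspec, Matrix.mul_assoc, hV1, Matrix.mul_one]
  have hsq : ∀ i, ((√(l i) : ℝ) : ℂ) * √(l i) = l i := fun i => by
    exact_mod_cast Real.mul_self_sqrt (hl0 i)
  refine ⟨V * S * Vᴴ * Aᴴ, ?_, ?_⟩
  · intro u v
    have h1 : sesq (V * S * Vᴴ * Aᴴ) u v = star ((A * V * S * Vᴴ) *ᵥ u) ⬝ᵥ v := by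
      rw [sesq_eq_dotProduct, Matrix.star_mulVec, ← Matrix.dotProduct_mulVec]
      simp only [Matrix.conjTranspose_mul, Matrix.conjTranspose_conjTranspose, hSH,
        Matrix.mul_assoc]
    rw [h1]
    refine (norm_star_dotProduct_le _ _).trans
      (mul_le_mul_of_nonneg_right (Real.sqrt_le_sqrt ?_) (Real.sqrt_nonneg _))
    set z := Vᴴ *ᵥ u with hz
    have hzu : l2sq z = l2sq u := l2sq_mulVec (by simpa using hV2) u
    rw [← hzu]
    have h2 : (l2sq ((A * V * S * Vᴴ) *ᵥ u) : ℂ) =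
        star z ⬝ᵥ (Matrix.diagonal (fun i => ((√(l i))⁻¹ * l i * (√(l i))⁻¹ : ℂ)) *ᵥ z) := by
      rw [l2sq_eq_star_dotProduct, ← Matrix.mulVec_mulVec, ← hz, Matrix.star_mulVec,
        ← Matrix.dotProduct_mulVec, Matrix.mulVec_mulVec]
      congr 2
      rw [Matrix.conjTranspose_mul, Matrix.conjTranspose_mul, hSH]
      calc S * (Vᴴ * Aᴴ) * (A * V * S) = S * (Vᴴ * (Aᴴ * A * V)) * S := by
            simp only [Matrix.mul_assoc]
        _ = _ := by
            rw [hkey, ← Matrix.mul_assoc Vᴴ, hV1, Matrix.one_mul, hS,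
              Matrix.diagonal_mul_diagonal, Matrix.diagonal_mul_diagonal]
            push_cast
            rfl
    have h3 : l2sq ((A * V * S * Vᴴ) *ᵥ u) =
        ∑ i, ((√(l i))⁻¹ * l i * (√(l i))⁻¹) * ‖z i‖ ^ 2 := by
      have : (l2sq ((A * V * S * Vᴴ) *ᵥ u) : ℂ) =
          ((∑ i, ((√(l i))⁻¹ * l i * (√(l i))⁻¹) * ‖z i‖ ^ 2 : ℝ) : ℂ) := by
        rw [h2, dotProduct, Complex.ofReal_sum]
        refine Finset.sum_congr rfl fun i _ => ?_
        rw [Matrix.mulVec_diagonal, Pi.star_apply, Complex.star_def, mul_left_comm,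
          ← Complex.normSq_eq_conj_mul_self, Complex.normSq_eq_norm_sq]
        push_cast
        ring
      exact_mod_cast this
    rw [h3]
    refine Finset.sum_le_sum fun i _ => mul_le_of_le_one_left (sq_nonneg _) ?_
    rcases (hl0 i).eq_or_lt with h | h
    · simp [← h]
    · have h4 : 0 < √(l i) := Real.sqrt_pos.mpr h
      have h5 := Real.mul_self_sqrt (hl0 i)
      refine le_of_eq ?_
      field_simp
      nlinarith
  · rw [Matrix.mul_assoc, Matrix.trace_mul_comm, ← Matrix.mul_assoc, ← Matrix.mul_assoc, hkey,
      Matrix.trace_mul_comm, Matrix.mul_assoc V, hS, Matrix.diagonal_mul_diagonal,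
      ← Matrix.mul_assoc, hV1, Matrix.one_mul, Matrix.trace_diagonal, traceNorm,
      Complex.ofReal_sum]
    refine Finset.sum_congr rfl fun i _ => ?_
    rw [← hl, ← hsq i]
    by_cases h : (√(l i) : ℂ) = 0
    · simp [h]
    · field_simp

/-- Perturbing the vector perturbs the quadratic form of a contraction linearly. -/
theorem norm_sesq_self_sub_le {W : Matrix α α ℂ} (hW : IsContraction W) (u v : α → ℂ)
    (hu : l2sq u ≤ 1) (hv : l2sq v ≤ 1) :
    ‖sesq W u u - sesq W v v‖ ≤ 2 * √(l2sq (u - v)) := by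
  have h : sesq W u u - sesq W v v = sesq W (u - v) u + sesq W v (u - v) := by
    simp only [sesq, ← Finset.sum_sub_distrib, ← Finset.sum_add_distrib, Pi.sub_apply, star_sub]
    refine Finset.sum_congr rfl fun p _ => Finset.sum_congr rfl fun q _ => by ring
  have h1 := hW (u - v) u
  have h2 := hW v (u - v)
  have h3 : √(l2sq u) ≤ 1 := Real.sqrt_le_one.mpr hu
  have h4 : √(l2sq v) ≤ 1 := Real.sqrt_le_one.mpr hv
  have h5 := Real.sqrt_nonneg (l2sq (u - v))
  rw [h]
  refine (norm_add_le _ _).trans ?_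
  nlinarith

end Contraction

/-! ### Tensor powers acting on half of a bipartite vector. -/

section TensorPower

variable {ι η : Type*} {t : ℕ}

theorem tensorPow_conjTranspose (U : Matrix ι ι ℂ) :
    (tensorPow t U)ᴴ = tensorPow t Uᴴ := by
  ext x y
  simp [tensorPow, Matrix.conjTranspose_apply]

theorem tensorPow_one [DecidableEq ι] : tensorPow t (1 : Matrix ι ι ℂ) = 1 := by
  ext x y
  simp only [tensorPow, Matrix.of_apply, Matrix.one_apply, Finset.prod_ite_zero, Finset.mem_univ,
    forall_true_left, Finset.prod_const_one, funext_iff]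

variable [Fintype ι]

theorem tensorPow_mul (U V : Matrix ι ι ℂ) :
    tensorPow t (U * V) = tensorPow t U * tensorPow t V := by
  ext x y
  simp only [tensorPow, Matrix.of_apply, Matrix.mul_apply, ← Finset.prod_mul_distrib]
  rw [Finset.prod_univ_sum, Fintype.piFinset_univ]

theorem tensorPow_conjTranspose_mul_self [DecidableEq ι] (U : Matrix.unitaryGroup ι ℂ) :
    (tensorPow t (U : Matrix ι ι ℂ))ᴴ * tensorPow t (U : Matrix ι ι ℂ) = 1 := by
  rw [tensorPow_conjTranspose, ← tensorPow_mul, ← Matrix.star_eq_conjTranspose,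
    Matrix.mem_unitaryGroup_iff'.mp U.2, tensorPow_one]

/-- The action of `U^{⊗ t} ⊗ id` on vectors. -/
def tensorAct (U : Matrix ι ι ℂ) (φ : (Fin t → ι) × η → ℂ) : (Fin t → ι) × η → ℂ :=
  fun p => (tensorPow t U *ᵥ fun a => φ (a, p.2)) p.1

theorem tensorAct_mul (U V : Matrix ι ι ℂ) (φ : (Fin t → ι) × η → ℂ) :
    tensorAct (U * V) φ = tensorAct U (tensorAct V φ) := by
  funext p
  simp only [tensorAct, tensorPow_mul, ← Matrix.mulVec_mulVec]

theorem tensorAct_sub (U : Matrix ι ι ℂ) (φ χ : (Fin t → ι) × η → ℂ) :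
    tensorAct U (φ - χ) = tensorAct U φ - tensorAct U χ := by
  funext p
  simp only [tensorAct, Pi.sub_apply]
  rw [← Pi.sub_apply, ← Matrix.mulVec_sub]
  rfl

theorem l2sq_prod {α : Type*} [Fintype α] [Fintype η] (φ : α × η → ℂ) :
    l2sq φ = ∑ r, l2sq fun a => φ (a, r) := by
  simp only [l2sq, Fintype.sum_prod_type_right]

theorem l2sq_tensorAct [DecidableEq ι] [Fintype η] (U : Matrix.unitaryGroup ι ℂ)
    (φ : (Fin t → ι) × η → ℂ) : l2sq (tensorAct (U : Matrix ι ι ℂ) φ) = l2sq φ := by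
  rw [l2sq_prod, l2sq_prod]
  refine Finset.sum_congr rfl fun r _ => ?_
  rw [← l2sq_mulVec (tensorPow_conjTranspose_mul_self (t := t) U) fun a => φ (a, r)]
  rfl

variable [DecidableEq ι]

theorem continuous_tensorAct (φ : (Fin t → ι) × η → ℂ) :
    Continuous fun U : Matrix.unitaryGroup ι ℂ => tensorAct (U : Matrix ι ι ℂ) φ := by
  unfold tensorAct tensorPow Matrix.mulVec dotProduct
  simp only [Matrix.of_apply]
  refine continuous_pi fun p => continuous_finsetSum _ fun a _ => ?_
  refine Continuous.mul (continuous_finsetProd _ fun i _ => ?_) continuous_const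
  exact continuous_subtype_val.matrix_elem _ _

theorem continuous_sesq {α X : Type*} [Fintype α] [TopologicalSpace X] (W : Matrix α α ℂ)
    {u v : X → α → ℂ} (hu : Continuous u) (hv : Continuous v) :
    Continuous fun x => sesq W (u x) (v x) := by
  unfold sesq
  fun_prop

theorem integrable_of_continuous_unitaryGroup {E : Type*} [NormedAddCommGroup E]
    [SecondCountableTopologyEither (Matrix.unitaryGroup ι ℂ) E]
    (ν : Measure (Matrix.unitaryGroup ι ℂ)) [IsFiniteMeasure ν]
    {h : Matrix.unitaryGroup ι ℂ → E} (hh : Continuous h) : Integrable h ν :=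
  hh.integrable_of_hasCompactSupport (HasCompactSupport.of_compactSpace h)

/-- The extended twirl of `|ψ⟩⟨ψ|` is the average of the rank-one projectors onto `(R^{⊗t} ⊗ id)ψ`.
This turns the dual expression for the trace norm into averages of quadratic forms. -/
theorem trace_mul_extendById_twirl {ψ : EuclideanSpace ℂ ((Fin t → ι) × (Fin t → ι))}
    (ν : Measure (Matrix.unitaryGroup ι ℂ)) [IsFiniteMeasure ν]
    (W : Matrix ((Fin t → ι) × (Fin t → ι)) ((Fin t → ι) × (Fin t → ι)) ℂ) :
    (W * extendById (twirl ν t) (proj ψ)).trace =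
      ∫ R, sesq W (tensorAct (R : Matrix ι ι ℂ) ψ) (tensorAct (R : Matrix ι ι ℂ) ψ) ∂ν := by
  have hentry : ∀ p q, extendById (twirl ν t) (proj ψ) p q =
      ∫ R, tensorAct (R : Matrix ι ι ℂ) ψ p * star (tensorAct (R : Matrix ι ι ℂ) ψ q) ∂ν := by
    intro p q
    simp only [extendById, twirl, Matrix.of_apply]
    refine integral_congr_ae (Filter.Eventually.of_forall fun R => ?_)
    simp only [tensorAct, Matrix.mulVec, dotProduct, Matrix.mul_apply, proj, Matrix.of_apply,
      Matrix.conjTranspose_apply, star_sum, star_mul', Finset.sum_mul, Finset.mul_sum]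
    refine Finset.sum_congr rfl fun a _ => Finset.sum_congr rfl fun b _ => by ring
  have hcont : ∀ p, Continuous fun R : Matrix.unitaryGroup ι ℂ =>
      tensorAct (R : Matrix ι ι ℂ) (ψ : _ → ℂ) p := fun p =>
    (continuous_apply p).comp (continuous_tensorAct _)
  simp only [sesq, Matrix.trace, Matrix.diag, Matrix.mul_apply, hentry]
  rw [integral_finsetSum _ fun p _ => integrable_of_continuous_unitaryGroup ν (by fun_prop)]
  refine Finset.sum_congr rfl fun p _ => ?_
  rw [integral_finsetSum _ fun q _ => integrable_of_continuous_unitaryGroup ν (by fun_prop)]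
  refine Finset.sum_congr rfl fun q _ => ?_
  rw [← integral_const_mul]
  exact integral_congr_ae (Filter.Eventually.of_forall fun R => by ring)

end TensorPower

/-! ### Averaging over permutation and phase before the remaining unitary. -/

section Ensemble

instance isProbabilityMeasure_haarProb (G : Type*) [Group G] [TopologicalSpace G]
    [IsTopologicalGroup G] [CompactSpace G] [MeasurableSpace G] [BorelSpace G] :
    IsProbabilityMeasure (haarProb G) :=
  ⟨by simpa [haarProb] using
    Measure.haarMeasure_self (K₀ := (⊤ : TopologicalSpace.PositiveCompacts G))⟩

instance isMulLeftInvariant_haarProb (G : Type*) [Group G] [TopologicalSpace G]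
    [IsTopologicalGroup G] [CompactSpace G] [MeasurableSpace G] [BorelSpace G] :
    (haarProb G).IsMulLeftInvariant :=
  inferInstanceAs (Measure.haarMeasure _).IsMulLeftInvariant

/-- The law of a Haar random Clifford unitary. -/
def cliffordLaw (n : ℕ) : Measure (Matrix.unitaryGroup (Bits n) ℂ) :=
  Measure.map Subtype.val (haarProb (cliffordGroup n))

instance (n : ℕ) : IsProbabilityMeasure (cliffordLaw n) :=
  Measure.isProbabilityMeasure_map measurable_subtype_coe.aemeasurable

theorem integral_cliffordLaw_mul_left {n : ℕ} {E : Type*} [NormedAddCommGroup E] [NormedSpace ℝ E]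
    [SecondCountableTopologyEither (Matrix.unitaryGroup (Bits n) ℂ) E]
    {V : Matrix.unitaryGroup (Bits n) ℂ} (hV : V ∈ cliffordGroup n)
    {h : Matrix.unitaryGroup (Bits n) ℂ → E} (hh : Continuous h) :
    ∫ U, h (V * U) ∂cliffordLaw n = ∫ U, h U ∂cliffordLaw n := by
  rw [cliffordLaw, integral_map measurable_subtype_coe.aemeasurable hh.aestronglyMeasurable,
    integral_map measurable_subtype_coe.aemeasurable
      (f := fun U => h (V * U)) (hh.comp (continuous_const_mul V)).aestronglyMeasurable]
  exact integral_mul_left_eq_self (μ := haarProb (cliffordGroup n))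
    (fun C : cliffordGroup n => h C) ⟨V, hV⟩

variable {n : ℕ} (D : PMF (Equiv.Perm (Bits n))) (F : PMF (Bits n → ZMod 2))

theorem PMF.sum_toReal_eq_one {α : Type*} [Fintype α] (p : PMF α) : ∑ a, (p a).toReal = 1 := by
  rw [← ENNReal.toReal_sum fun a _ => p.apply_ne_top a, ← tsum_fintype (L := .unconditional _),
    p.tsum_coe, ENNReal.toReal_one]

theorem pfcEnsemble_eq :
    pfcEnsemble n D F = ∑ π, ∑ f, (D π * F f) •
      Measure.map (fun U => permOp π * phaseOp f * U) (cliffordLaw n) := by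
  unfold pfcEnsemble cliffordLaw
  refine Finset.sum_congr rfl fun π _ => Finset.sum_congr rfl fun f _ => ?_
  rw [Measure.map_map (continuous_const_mul _).measurable measurable_subtype_coe]
  rfl

theorem pmf_mul_ne_top (π : Equiv.Perm (Bits n)) (f : Bits n → ZMod 2) : D π * F f ≠ ∞ :=
  ENNReal.mul_ne_top (D.apply_ne_top π) (F.apply_ne_top f)

instance : IsFiniteMeasure (pfcEnsemble n D F) := by
  rw [pfcEnsemble_eq]
  have : ∀ π f, IsFiniteMeasure ((D π * F f) •
      Measure.map (fun U => permOp π * phaseOp f * U) (cliffordLaw n)) := fun π f =>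
    Measure.smul_finite _ (pmf_mul_ne_top D F π f)
  infer_instance

/-- The average of a function of `P_π F_f U` over `π ∼ D` and `f ∼ F`. -/
def pfMean (h : Matrix.unitaryGroup (Bits n) ℂ → ℂ) (U : Matrix.unitaryGroup (Bits n) ℂ) : ℂ :=
  ∑ π, ∑ f, ((D π).toReal * (F f).toReal : ℂ) * h (permOp π * phaseOp f * U)

theorem integral_pfMean (μ : Measure (Matrix.unitaryGroup (Bits n) ℂ)) [IsFiniteMeasure μ]
    {h : Matrix.unitaryGroup (Bits n) ℂ → ℂ} (hh : Continuous h) :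
    ∫ U, pfMean D F h U ∂μ = ∑ π, ∑ f, ((D π).toReal * (F f).toReal : ℂ) *
      ∫ U, h (permOp π * phaseOp f * U) ∂μ := by
  unfold pfMean
  rw [integral_finsetSum _ fun p _ => integrable_of_continuous_unitaryGroup μ (by fun_prop)]
  refine Finset.sum_congr rfl fun p _ => ?_
  rw [integral_finsetSum _ fun q _ => integrable_of_continuous_unitaryGroup μ (by fun_prop)]
  exact Finset.sum_congr rfl fun q _ => integral_const_mul _ _

theorem integral_pfcEnsemble {h : Matrix.unitaryGroup (Bits n) ℂ → ℂ} (hh : Continuous h) :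
    ∫ U, h U ∂pfcEnsemble n D F = ∫ U, pfMean D F h U ∂cliffordLaw n := by
  have hfin : ∀ π f, IsFiniteMeasure ((D π * F f) •
      Measure.map (fun U => permOp π * phaseOp f * U) (cliffordLaw n)) := fun π f =>
    Measure.smul_finite _ (pmf_mul_ne_top D F π f)
  rw [integral_pfMean D F _ hh, pfcEnsemble_eq, integral_finsetSum_measure fun π _ =>
    integrable_of_continuous_unitaryGroup _ hh]
  refine Finset.sum_congr rfl fun π _ => ?_
  rw [integral_finsetSum_measure fun f _ => integrable_of_continuous_unitaryGroup _ hh]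
  refine Finset.sum_congr rfl fun f _ => ?_
  rw [integral_smul_measure, integral_map (continuous_const_mul _).aemeasurable
    hh.aestronglyMeasurable, ENNReal.toReal_mul, Complex.real_smul, Complex.ofReal_mul]

/-- Left invariance absorbs each `P_π F_f` separately, and the weights sum to one. This puts the
Haar average in the same form as the average over the ensemble. -/
theorem integral_haarProb_eq_integral_pfMean {h : Matrix.unitaryGroup (Bits n) ℂ → ℂ}
    (hh : Continuous h) :
    ∫ U, h U ∂haarProb (Matrix.unitaryGroup (Bits n) ℂ) =
      ∫ U, pfMean D F h U ∂haarProb (Matrix.unitaryGroup (Bits n) ℂ) := by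
  rw [integral_pfMean D F _ hh]
  simp only [integral_mul_left_eq_self]
  simp only [← Finset.sum_mul, ← Finset.mul_sum]
  simp only [← Complex.ofReal_sum, PMF.sum_toReal_eq_one]
  simp

end Ensemble

/-! ### Sign averages of `2t`-wise independent functions. -/

section Independence

variable {ι : Type*} {t : ℕ}

/-- The eigenvalue of `F_f^{⊗ t}` at the basis vector `x`. -/
def phaseSign (f : ι → ZMod 2) (x : Fin t → ι) : ℂ := ∏ i, (-1) ^ (f (x i)).val

theorem neg_one_pow_val_mul_self (v : ZMod 2) : (-1 : ℂ) ^ v.val * (-1) ^ v.val = 1 := by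
  rw [← mul_pow]
  simp

theorem phaseSign_comp_perm (f : ι → ZMod 2) (x : Fin t → ι) (σ : Equiv.Perm (Fin t)) :
    phaseSign f (x ∘ σ) = phaseSign f x :=
  Equiv.prod_comp σ fun i => (-1 : ℂ) ^ (f (x i)).val

theorem phaseSign_mul_self (f : ι → ZMod 2) (x : Fin t → ι) :
    phaseSign f x * phaseSign f x = 1 := by
  simp only [phaseSign, ← Finset.prod_mul_distrib, neg_one_pow_val_mul_self, Finset.prod_const_one]

theorem star_phaseSign (f : ι → ZMod 2) (x : Fin t → ι) :
    star (phaseSign f x) = phaseSign f x := by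
  simp [phaseSign]

theorem PMF.toReal_toOuterMeasure_apply {α : Type*} [Fintype α] (p : PMF α) (s : Set α)
    [DecidablePred (· ∈ s)] :
    (p.toOuterMeasure s).toReal = ∑ a, if a ∈ s then (p a).toReal else 0 := by
  classical
  rw [PMF.toOuterMeasure_apply_fintype, ENNReal.toReal_sum]
  · refine Finset.sum_congr rfl fun a _ => ?_
    by_cases h : a ∈ s <;> simp [Set.indicator, h]
  · intro a _
    by_cases h : a ∈ s <;> simp [Set.indicator, h, p.apply_ne_top]

theorem exists_perm_of_image_eq [DecidableEq ι] {x y : Fin t → ι} (hy : Function.Injective y)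
    (h : Finset.univ.image x = Finset.univ.image y) :
    ∃ σ : Equiv.Perm (Fin t), y = x ∘ σ := by
  have h1 : ∀ i, ∃ j, x j = y i := fun i => by
    have : y i ∈ Finset.univ.image x := h ▸ Finset.mem_image_of_mem y (Finset.mem_univ i)
    simpa using this
  choose s hs using h1
  have hinj : Function.Injective s := fun i j hij => hy (by rw [← hs, ← hs, hij])
  exact ⟨Equiv.ofBijective s (Finite.injective_iff_bijective.mp hinj), funext fun i => (hs i).symm⟩

variable [Fintype ι] [DecidableEq ι]

/-- The average factorises over the points, and any point of `S` contributes the factor `1 + (-1) =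
0`. -/
theorem sum_pmf_mul_prod_sign_eq_zero {k : ℕ} {F : PMF (ι → ZMod 2)} (hF : IsTWiseIndependent k F)
    (hk : k ≤ Fintype.card ι) {S : Finset ι} (hS : S.Nonempty) (hSk : S.card ≤ k) :
    ∑ f, ((F f).toReal : ℂ) * ∏ a ∈ S, (-1 : ℂ) ^ (f a).val = 0 := by
  -- Independence is assumed for exactly `k` points, so `S` is padded to that size; the added points
  -- carry the factor `1`.
  obtain ⟨S', hSS', hcard⟩ := Finset.exists_superset_card_eq hSk hk
  let e : Fin k ≃ S' := (S'.equivFinOfCardEq hcard).symm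
  let x : Fin k → ι := fun i => e i
  have hx : Function.Injective x := Subtype.val_injective.comp e.injective
  let g : (Fin k → ZMod 2) → ℂ := fun y => ∏ i, if x i ∈ S then (-1) ^ (y i).val else 1
  have hg : ∀ f : ι → ZMod 2, ∏ a ∈ S, (-1 : ℂ) ^ (f a).val = g (f ∘ x) := by
    intro f
    have h1 : ∏ a ∈ S, (-1 : ℂ) ^ (f a).val =
        ∏ a ∈ S', if a ∈ S then (-1 : ℂ) ^ (f a).val else 1 := by
      rw [Finset.prod_ite_mem, Finset.inter_eq_right.mpr hSS']
    rw [h1, ← Finset.prod_coe_sort, ← e.prod_comp]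
    rfl
  have hfib : ∀ f : ι → ZMod 2, ((F f).toReal : ℂ) * g (f ∘ x) =
      ∑ y, (if ∀ i, f (x i) = y i then ((F f).toReal : ℂ) else 0) * g y := by
    intro f
    rw [Finset.sum_eq_single (f ∘ x)]
    · simp
    · intro y _ hy
      rw [if_neg fun h => hy (funext fun i => (h i).symm), zero_mul]
    · simp
  have hpr : ∀ y : Fin k → ZMod 2,
      ∑ f : ι → ZMod 2, (if ∀ i, f (x i) = y i then ((F f).toReal : ℂ) else 0) =
        (((2 : ℝ) ^ k)⁻¹ : ℝ) := by
    intro y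
    have h := hF x y hx
    rw [PMF.toReal_toOuterMeasure_apply, ZMod.card] at h
    have h' := congrArg (fun r : ℝ => (r : ℂ)) h
    simp only [Complex.ofReal_sum] at h'
    rw [Nat.cast_ofNat] at h'
    rw [← h']
    refine Finset.sum_congr rfl fun f _ => ?_
    simp only [Set.mem_ofPred_eq]
    split_ifs <;> simp
  have hzero : ∑ y, g y = 0 := by
    obtain ⟨a, ha⟩ := hS
    let i₀ := e.symm ⟨a, hSS' ha⟩
    have hi₀ : x i₀ ∈ S := by simpa [x, i₀] using ha
    have h := Finset.prod_univ_sum (fun _ : Fin k => (Finset.univ : Finset (ZMod 2)))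
      (fun i v => if x i ∈ S then (-1 : ℂ) ^ v.val else 1)
    rw [Fintype.piFinset_univ] at h
    rw [← h]
    refine Finset.prod_eq_zero (Finset.mem_univ i₀) ?_
    simp only [hi₀, if_true]
    change ∑ v : Fin 2, (-1 : ℂ) ^ (ZMod.val (n := 2) v) = 0
    rw [Fin.sum_univ_two]
    change (-1 : ℂ) ^ 0 + (-1) ^ 1 = 0
    norm_num
  simp only [hg, hfib]
  rw [Finset.sum_comm]
  simp only [← Finset.sum_mul, hpr]
  rw [← Finset.mul_sum, hzero, mul_zero]

/-- On distinct tuples, averaging a `2t`-wise independent phase leaves only permuted pairs. -/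
theorem sum_pmf_mul_phaseSign {F : PMF (ι → ZMod 2)} (hF : IsTWiseIndependent (2 * t) F)
    (ht : 2 * t ≤ Fintype.card ι) {x y : Fin t → ι} (hx : Function.Injective x)
    (hy : Function.Injective y) [Decidable (∃ σ : Equiv.Perm (Fin t), y = x ∘ σ)] :
    ∑ f, ((F f).toReal : ℂ) * (phaseSign f x * phaseSign f y) =
      if ∃ σ : Equiv.Perm (Fin t), y = x ∘ σ then 1 else 0 := by
  split_ifs with h
  · obtain ⟨σ, rfl⟩ := h
    simp only [phaseSign_comp_perm, phaseSign_mul_self, mul_one]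
    rw [← Complex.ofReal_sum, PMF.sum_toReal_eq_one, Complex.ofReal_one]
  · set A := Finset.univ.image x with hA
    set B := Finset.univ.image y with hB
    have hAB : A ≠ B := fun hAB => h (exists_perm_of_image_eq hy hAB)
    -- Signs at common labels square to one, which leaves a sign product over the symmetric
    -- difference. It is nonempty, and has at most `2t` elements.
    have hne : ((A \ B) ∪ (B \ A)).Nonempty := by
      rw [Finset.nonempty_iff_ne_empty]
      intro h0
      rw [Finset.union_eq_empty, Finset.sdiff_eq_empty_iff_subset,
        Finset.sdiff_eq_empty_iff_subset] at h0
      exact hAB (h0.1.antisymm h0.2)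
    have hcA : A.card ≤ t := Finset.card_image_le.trans (by simp)
    have hcB : B.card ≤ t := Finset.card_image_le.trans (by simp)
    have hcard : ((A \ B) ∪ (B \ A)).card ≤ 2 * t := by
      have h1 := Finset.card_union_le (A \ B) (B \ A)
      have h2 := Finset.card_le_card (Finset.sdiff_subset (s := A) (t := B))
      have h3 := Finset.card_le_card (Finset.sdiff_subset (s := B) (t := A))
      omega
    rw [← sum_pmf_mul_prod_sign_eq_zero hF ht hne hcard]
    refine Finset.sum_congr rfl fun f _ => ?_
    have h1 : phaseSign f x = ∏ a ∈ A, (-1 : ℂ) ^ (f a).val :=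
      (Finset.prod_image (f := fun a => (-1 : ℂ) ^ (f a).val) fun i _ j _ hij => hx hij).symm
    have h2 : phaseSign f y = ∏ a ∈ B, (-1 : ℂ) ^ (f a).val :=
      (Finset.prod_image (f := fun a => (-1 : ℂ) ^ (f a).val) fun i _ j _ hij => hy hij).symm
    have h3 : (∏ a ∈ A ∩ B, (-1 : ℂ) ^ (f a).val) * ∏ a ∈ B ∩ A, (-1 : ℂ) ^ (f a).val = 1 := by
      rw [Finset.inter_comm B A, ← Finset.prod_mul_distrib]
      simp only [neg_one_pow_val_mul_self, Finset.prod_const_one]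
    rw [h1, h2, Finset.prod_union (Finset.disjoint_left.mpr fun a ha hb => by
      simp only [Finset.mem_sdiff] at ha hb
      exact ha.2 hb.1), ← Finset.prod_inter_mul_prod_sdiff A B, ← Finset.prod_inter_mul_prod_sdiff B A]
    linear_combination (((F f).toReal : ℂ) * (∏ a ∈ A \ B, (-1 : ℂ) ^ (f a).val) *
      ∏ a ∈ B \ A, (-1 : ℂ) ^ (f a).val) * h3

end Independence

/-! ### Averaging the quadratic form over `F_f` and then over `P_π`. -/

section PermutationPhase

variable {ι η : Type*} [Fintype ι] {t : ℕ}

theorem sum_eq_sum_embedding {M : Type*} [AddCommMonoid M] (g : (Fin t → ι) → M)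
    (hg : ∀ x, ¬ Function.Injective x → g x = 0) :
    ∑ x, g x = ∑ e : Fin t ↪ ι, g e :=
  (Fintype.sum_of_injective (fun e : Fin t ↪ ι => (e : Fin t → ι)) DFunLike.coe_injective _ _
    (fun x hx => hg x fun h => hx ⟨⟨x, h⟩, rfl⟩) fun _ => rfl).symm

variable [DecidableEq ι]

theorem tensorAct_permOp_mul_phaseOp (π : Equiv.Perm ι) (f : ι → ZMod 2)
    (φ : (Fin t → ι) × η → ℂ) (x : Fin t → ι) (r : η) :
    tensorAct ((permOp π * phaseOp f : Matrix.unitaryGroup ι ℂ) : Matrix ι ι ℂ) φ (π ∘ x, r) =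
      phaseSign f x * φ (x, r) := by
  have hentry : ∀ a : Fin t → ι, tensorPow t ((permOp π * phaseOp f :
      Matrix.unitaryGroup ι ℂ) : Matrix ι ι ℂ) (π ∘ x) a = if a = x then phaseSign f x else 0 := by
    intro a
    have h1 : ∀ i, ((permOp π * phaseOp f : Matrix.unitaryGroup ι ℂ) : Matrix ι ι ℂ) (π (x i)) (a i)
        = if a i = x i then (-1) ^ (f (x i)).val else 0 := by
      intro i
      simp only [permOp, phaseOp, Matrix.UnitaryGroup.mul_val, Matrix.mul_diagonal,
        Matrix.of_apply, EmbeddingLike.apply_eq_iff_eq, eq_comm (a := x i)]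
      split_ifs with h
      · rw [h, one_mul]
      · rw [zero_mul]
    simp only [tensorPow, Matrix.of_apply, Function.comp_apply, h1, Finset.prod_ite_zero,
      Finset.mem_univ, forall_true_left, funext_iff, phaseSign]
  simp only [tensorAct, Matrix.mulVec, dotProduct, hentry]
  simp

variable [Fintype η]

/-- The block of `⟨φ, W φ⟩` pairing the tuple `x` with its rearrangement by `σ`, with the entries of
`W` read at `x'` instead. -/
def blockForm (W : Matrix ((Fin t → ι) × η) ((Fin t → ι) × η) ℂ) (φ : (Fin t → ι) × η → ℂ)
    (x x' : Fin t → ι) (σ : Equiv.Perm (Fin t)) : ℂ :=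
  ∑ r, ∑ s, star (φ (x, r)) * W (x', r) (x' ∘ σ, s) * φ (x ∘ σ, s)

theorem sesq_tensorAct_permOp_mul_phaseOp
    (W : Matrix ((Fin t → ι) × η) ((Fin t → ι) × η) ℂ) (φ : (Fin t → ι) × η → ℂ)
    (π : Equiv.Perm ι) (f : ι → ZMod 2) :
    sesq W (tensorAct ((permOp π * phaseOp f : Matrix.unitaryGroup ι ℂ) : Matrix ι ι ℂ) φ)
      (tensorAct ((permOp π * phaseOp f : Matrix.unitaryGroup ι ℂ) : Matrix ι ι ℂ) φ) =
    ∑ x : Fin t → ι, ∑ y : Fin t → ι, phaseSign f x * phaseSign f y *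
      ∑ r, ∑ s, star (φ (x, r)) * W (π ∘ x, r) (π ∘ y, s) * φ (y, s) := by
  let e : (Fin t → ι) ≃ (Fin t → ι) := Equiv.arrowCongr (Equiv.refl _) π
  have he : ∀ x, e x = π ∘ x := fun x => rfl
  simp only [sesq, Fintype.sum_prod_type]
  rw [← e.sum_comp]
  refine Finset.sum_congr rfl fun x _ => ?_
  simp only [Finset.mul_sum]
  rw [Finset.sum_comm]
  rw [← e.sum_comp]
  refine Finset.sum_congr rfl fun y _ => Finset.sum_congr rfl fun r _ =>
    Finset.sum_congr rfl fun s _ => ?_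
  simp only [he, tensorAct_permOp_mul_phaseOp, star_mul', star_phaseSign]
  ring

/-- The probability that `π` maps the tuple `x` to the tuple `y`. -/
def permProb (D : PMF (Equiv.Perm ι)) (x y : Fin t → ι) : ℝ :=
  (D.toOuterMeasure {π | ∀ i, π (x i) = y i}).toReal

/-- Among the pairs of distinct tuples only `y = x ∘ σ` survive the phase average; `σ` is unique
because `x` is injective. -/
theorem sum_pmf_sesq_tensorAct {F : PMF (ι → ZMod 2)} (hF : IsTWiseIndependent (2 * t) F)
    (ht : 2 * t ≤ Fintype.card ι) (W : Matrix ((Fin t → ι) × η) ((Fin t → ι) × η) ℂ)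
    {φ : (Fin t → ι) × η → ℂ} (hφ : ∀ x r, ¬ Function.Injective x → φ (x, r) = 0)
    (π : Equiv.Perm ι) :
    ∑ f, ((F f).toReal : ℂ) *
      sesq W (tensorAct ((permOp π * phaseOp f : Matrix.unitaryGroup ι ℂ) : Matrix ι ι ℂ) φ)
        (tensorAct ((permOp π * phaseOp f : Matrix.unitaryGroup ι ℂ) : Matrix ι ι ℂ) φ) =
      ∑ x : Fin t ↪ ι, ∑ σ : Equiv.Perm (Fin t), blockForm W φ x (π ∘ x) σ := by
  classical
  simp only [sesq_tensorAct_permOp_mul_phaseOp, Finset.mul_sum]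
  rw [Finset.sum_comm]
  rw [sum_eq_sum_embedding]
  swap
  · intro x hx
    simp [hφ x _ hx]
  refine Finset.sum_congr rfl fun x _ => ?_
  rw [Finset.sum_comm]
  symm
  refine Fintype.sum_of_injective (fun σ : Equiv.Perm (Fin t) => (x : Fin t → ι) ∘ σ) ?_ _ _ ?_ ?_
  · intro σ τ h
    exact Equiv.ext fun i => x.injective (congrFun h i)
  · intro y hy
    by_cases hyi : Function.Injective y
    · have h := sum_pmf_mul_phaseSign hF ht x.injective hyi
      rw [if_neg fun ⟨σ, hσ⟩ => hy ⟨σ, hσ.symm⟩] at h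
      simp only [← Finset.mul_sum, ← mul_assoc (Complex.ofReal _), ← Finset.sum_mul]
      simp only [← mul_assoc] at h
      simp only [h, zero_mul]
    · simp [hφ y _ hyi]
  · intro σ
    simp only [phaseSign_comp_perm, phaseSign_mul_self, one_mul, ← Finset.mul_sum]
    rw [← Finset.sum_mul, ← Complex.ofReal_sum, PMF.sum_toReal_eq_one, Complex.ofReal_one, one_mul]
    rfl

/-- The average over a `2t`-wise independent phase and a random permutation of the quadratic form
of a vector supported on distinct tuples. -/
theorem sum_pmf_sum_pmf_sesq_tensorAct {F : PMF (ι → ZMod 2)} (hF : IsTWiseIndependent (2 * t) F)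
    (ht : 2 * t ≤ Fintype.card ι) (D : PMF (Equiv.Perm ι))
    (W : Matrix ((Fin t → ι) × η) ((Fin t → ι) × η) ℂ)
    {φ : (Fin t → ι) × η → ℂ} (hφ : ∀ x r, ¬ Function.Injective x → φ (x, r) = 0) :
    ∑ π, ∑ f, ((D π).toReal * (F f).toReal : ℂ) *
      sesq W (tensorAct ((permOp π * phaseOp f : Matrix.unitaryGroup ι ℂ) : Matrix ι ι ℂ) φ)
        (tensorAct ((permOp π * phaseOp f : Matrix.unitaryGroup ι ℂ) : Matrix ι ι ℂ) φ) =
      ∑ x : Fin t ↪ ι, ∑ σ : Equiv.Perm (Fin t), ∑ x' : Fin t ↪ ι,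
        (permProb D x x' : ℂ) * blockForm W φ x x' σ := by
  have h1 : ∀ (x x' : Fin t ↪ ι), (permProb D x x' : ℂ) =
      ∑ π : Equiv.Perm ι, if (π ∘ x : Fin t → ι) = x' then ((D π).toReal : ℂ) else 0 := by
    intro x x'
    rw [permProb, PMF.toReal_toOuterMeasure_apply, Complex.ofReal_sum]
    refine Finset.sum_congr rfl fun π _ => ?_
    simp only [Set.mem_ofPred_eq, funext_iff, Function.comp_apply]
    split_ifs <;> simp
  simp only [mul_assoc, ← Finset.mul_sum, sum_pmf_sesq_tensorAct hF ht W hφ]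
  simp only [Finset.mul_sum, h1, Finset.sum_mul]
  rw [Finset.sum_comm]
  refine Finset.sum_congr rfl fun x _ => ?_
  rw [Finset.sum_comm]
  refine Finset.sum_congr rfl fun σ _ => ?_
  rw [Finset.sum_comm]
  refine Finset.sum_congr rfl fun π _ => ?_
  rw [Finset.sum_eq_single (x.trans π.toEmbedding)]
  · have h2 : ((x.trans π.toEmbedding : Fin t ↪ ι) : Fin t → ι) = π ∘ x := rfl
    simp only [h2, if_true]
  · intro x' _ hx'
    rw [if_neg fun h => hx' (DFunLike.coe_injective h.symm), zero_mul]
  · simp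

end PermutationPhase

/-! ### The limiting form: approximation, norm bound and unitary invariance. -/

section MeanForm

variable {ι η : Type*} {t : ℕ}

/-- Precomposition of tuples with a permutation of the positions. -/
def permuteTuple (σ : Equiv.Perm (Fin t)) : (Fin t → ι) ≃ (Fin t → ι) :=
  Equiv.arrowCongr σ.symm (Equiv.refl ι)

theorem permuteTuple_apply (σ : Equiv.Perm (Fin t)) (x : Fin t → ι) :
    permuteTuple σ x = x ∘ σ := rfl

variable [Fintype ι] [Fintype η]

theorem l2sq_eq_sum_l2sq_fst {α : Type*} [Fintype α] (φ : α × η → ℂ) :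
    l2sq φ = ∑ x, l2sq fun r => φ (x, r) := by
  simp only [l2sq, Fintype.sum_prod_type]

/-- Test `W` against two vectors, supported over the single labels `x'` and `x' ∘ σ`. -/
theorem norm_blockForm_le {W : Matrix ((Fin t → ι) × η) ((Fin t → ι) × η) ℂ}
    (hW : IsContraction W) (φ : (Fin t → ι) × η → ℂ) (x x' : Fin t → ι)
    (σ : Equiv.Perm (Fin t)) :
    ‖blockForm W φ x x' σ‖ ≤
      √(l2sq fun r => φ (x, r)) * √(l2sq fun r => φ (x ∘ σ, r)) := by
  classical
  have h := hW (fun p => if p.1 = x' then φ (x, p.2) else 0)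
    (fun p => if p.1 = x' ∘ σ then φ (x ∘ σ, p.2) else 0)
  have h1 : ∀ (y : Fin t → ι) (u : η → ℂ),
      l2sq (fun p : (Fin t → ι) × η => if p.1 = y then u p.2 else 0) = l2sq u := by
    intro y u
    rw [l2sq_eq_sum_l2sq_fst, Finset.sum_eq_single y]
    · simp
    · intro b _ hb
      simp [hb, l2sq]
    · simp
  rw [h1 x' fun r => φ (x, r), h1 (x' ∘ σ) fun r => φ (x ∘ σ, r)] at h
  refine le_trans (le_of_eq ?_) h
  congr 1
  simp only [sesq, Fintype.sum_prod_type, blockForm]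
  rw [Finset.sum_eq_single x']
  · refine Finset.sum_congr rfl fun r _ => ?_
    rw [Finset.sum_eq_single (x' ∘ σ)]
    · simp
    · intro b _ hb
      simp [hb]
    · simp
  · intro b _ hb
    simp [hb]
  · simp

theorem sum_sqrt_l2sq_mul_le (φ : (Fin t → ι) × η → ℂ) (σ : Equiv.Perm (Fin t)) :
    ∑ x : Fin t → ι, √(l2sq fun r => φ (x, r)) * √(l2sq fun r => φ (x ∘ σ, r)) ≤ l2sq φ := by
  refine (Real.sum_sqrt_mul_sqrt_le _ (fun x => l2sq_nonneg _) fun x => l2sq_nonneg _).trans ?_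
  have h := (permuteTuple σ).sum_comp fun x : Fin t → ι => l2sq fun r => φ (x, r)
  simp only [permuteTuple_apply] at h
  rw [h, ← l2sq_eq_sum_l2sq_fst, Real.mul_self_sqrt (l2sq_nonneg _)]

/-- The mean over uniformly random phases and permutations of the quadratic form of `W`, extended
from vectors supported on distinct tuples to all vectors. -/
def meanForm (W : Matrix ((Fin t → ι) × η) ((Fin t → ι) × η) ℂ) (φ : (Fin t → ι) × η → ℂ) : ℂ :=
  ((Fintype.card ι).descFactorial t : ℂ)⁻¹ *
    ∑ x : Fin t → ι, ∑ σ : Equiv.Perm (Fin t), ∑ x' : Fin t ↪ ι, blockForm W φ x x' σ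

open Classical in
/-- The projection of `φ` onto tuples of distinct labels. -/
def distinctPart (φ : (Fin t → ι) × η → ℂ) : (Fin t → ι) × η → ℂ :=
  fun p => if Function.Injective p.1 then φ p else 0

/-- There are no cross terms: the form pairs `x` only with `x ∘ σ`, and these are injective
together. -/
theorem meanForm_eq_add (W : Matrix ((Fin t → ι) × η) ((Fin t → ι) × η) ℂ)
    (φ : (Fin t → ι) × η → ℂ) :
    meanForm W φ = meanForm W (distinctPart φ) + meanForm W (φ - distinctPart φ) := by
  simp only [meanForm, ← mul_add, ← Finset.sum_add_distrib]
  congr 1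
  refine Finset.sum_congr rfl fun x _ => Finset.sum_congr rfl fun σ _ =>
    Finset.sum_congr rfl fun x' _ => ?_
  by_cases hx : Function.Injective x
  · have hxs : Function.Injective (x ∘ σ) := hx.comp σ.injective
    simp [blockForm, distinctPart, hx, hxs]
  · simp [blockForm, distinctPart, hx]

/-- A crude bound, term by term. The factors counting `x'` and `σ` are affordable because the
assumed `δ` is of order `t d^{-4t-1/2}`. -/
theorem norm_sum_blockForm_sub_meanForm_le [DecidableEq ι]
    {W : Matrix ((Fin t → ι) × η) ((Fin t → ι) × η) ℂ}
    (hW : IsContraction W) {φ : (Fin t → ι) × η → ℂ}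
    (hφ : ∀ x r, ¬ Function.Injective x → φ (x, r) = 0) {D : PMF (Equiv.Perm ι)} {δ : ℝ}
    (hδ : 0 ≤ δ) (hD : ∀ x y : Fin t ↪ ι,
      |permProb D x y - ((Fintype.card ι).descFactorial t : ℝ)⁻¹| ≤ δ) :
    ‖∑ x : Fin t ↪ ι, ∑ σ : Equiv.Perm (Fin t), ∑ x' : Fin t ↪ ι,
        (permProb D x x' : ℂ) * blockForm W φ x x' σ - meanForm W φ‖ ≤
      δ * (Fintype.card ι).descFactorial t * t.factorial * l2sq φ := by
  have h1 : meanForm W φ = ∑ x : Fin t ↪ ι, ∑ σ : Equiv.Perm (Fin t), ∑ x' : Fin t ↪ ι,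
      (((Fintype.card ι).descFactorial t : ℝ)⁻¹ : ℝ) * blockForm W φ x x' σ := by
    rw [meanForm, sum_eq_sum_embedding]
    · simp only [Finset.mul_sum]
      push_cast
      rfl
    · intro x hx
      simp [blockForm, hφ x _ hx]
  rw [h1]
  simp only [← Finset.sum_sub_distrib, ← sub_mul, ← Complex.ofReal_sub]
  calc _ ≤ ∑ x : Fin t ↪ ι, ∑ σ : Equiv.Perm (Fin t), ∑ x' : Fin t ↪ ι,
        δ * (√(l2sq fun r => φ (x, r)) * √(l2sq fun r => φ (x ∘ σ, r))) := by
        refine (norm_sum_le _ _).trans (Finset.sum_le_sum fun x _ => ?_)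
        refine (norm_sum_le _ _).trans (Finset.sum_le_sum fun σ _ => ?_)
        refine (norm_sum_le _ _).trans (Finset.sum_le_sum fun x' _ => ?_)
        rw [norm_mul, Complex.norm_real]
        exact mul_le_mul (hD x x') (norm_blockForm_le hW φ x x' σ) (norm_nonneg _) hδ
    _ = (Fintype.card ι).descFactorial t * δ * ∑ σ : Equiv.Perm (Fin t), ∑ x : Fin t ↪ ι,
        (√(l2sq fun r => φ (x, r)) * √(l2sq fun r => φ (x ∘ σ, r))) := by
        rw [Finset.sum_comm]
        simp only [Finset.sum_const, Finset.card_univ, Fintype.card_embedding_eq,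
          Fintype.card_fin, nsmul_eq_mul, Finset.mul_sum, mul_assoc]
    _ ≤ (Fintype.card ι).descFactorial t * δ * ∑ _σ : Equiv.Perm (Fin t), l2sq φ := by
        refine mul_le_mul_of_nonneg_left (Finset.sum_le_sum fun σ _ => ?_) (by positivity)
        refine le_trans (le_of_eq ?_) (sum_sqrt_l2sq_mul_le φ σ)
        rw [sum_eq_sum_embedding]
        intro x hx
        simp [hφ x _ hx, l2sq]
    _ = _ := by
        rw [Finset.sum_const, Finset.card_univ, Fintype.card_perm, Fintype.card_fin, nsmul_eq_mul]
        ring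

/-- The double sum is a single quadratic form `⟨v, W v⟩`, with the values of `φ` on the orbit of `x`
transplanted to the orbit of `x'`. As `x'` is injective, `v` is well defined even when `x` has
repeated labels. Bounding the blocks one by one would cost a factor `t!`. -/
theorem norm_sum_blockForm_perm_le {W : Matrix ((Fin t → ι) × η) ((Fin t → ι) × η) ℂ}
    (hW : IsContraction W) (φ : (Fin t → ι) × η → ℂ) (x : Fin t → ι) (x' : Fin t ↪ ι) :
    ‖∑ τ : Equiv.Perm (Fin t), ∑ σ : Equiv.Perm (Fin t), blockForm W φ (x ∘ τ) (x' ∘ τ) σ‖ ≤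
      ∑ τ : Equiv.Perm (Fin t), l2sq fun r => φ (x ∘ τ, r) := by
  let e : Equiv.Perm (Fin t) × η → (Fin t → ι) × η := fun p => (x' ∘ p.1, p.2)
  have he : Function.Injective e := by
    rintro ⟨τ, r⟩ ⟨σ, s⟩ h
    simp only [e, Prod.mk.injEq] at h
    exact Prod.ext (Equiv.ext fun i => x'.injective (congrFun h.1 i)) h.2
  let v : (Fin t → ι) × η → ℂ := Function.extend e (fun p => φ (x ∘ p.1, p.2)) 0
  have hv : ∀ p, v (e p) = φ (x ∘ p.1, p.2) := he.extend_apply _ _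
  have hv' : ∀ (τ : Equiv.Perm (Fin t)) (r : η), v (x' ∘ τ, r) = φ (x ∘ τ, r) :=
    fun τ r => hv (τ, r)
  have hv0 : ∀ q, q ∉ Set.range e → v q = 0 := fun q hq => Function.extend_apply' _ _ _ hq
  have h1 : sesq W v v =
      ∑ τ : Equiv.Perm (Fin t), ∑ σ : Equiv.Perm (Fin t), blockForm W φ (x ∘ τ) (x' ∘ τ) σ := by
    have h2 : sesq W v v = ∑ p, ∑ q, star (v (e p)) * W (e p) (e q) * v (e q) := by
      unfold sesq
      rw [← Fintype.sum_of_injective e he (fun p => ∑ q, star (v (e p)) * W (e p) q * v q) _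
        (fun q hq => by simp [hv0 q hq]) fun p => rfl]
      refine Finset.sum_congr rfl fun p _ => ?_
      exact (Fintype.sum_of_injective e he _ _ (fun q hq => by simp [hv0 q hq]) fun q => rfl).symm
    rw [h2, Fintype.sum_prod_type]
    refine Finset.sum_congr rfl fun τ _ => ?_
    simp only [Fintype.sum_prod_type, e, hv']
    -- The second orbit point is written relative to the first, as `τ * σ`.
    rw [Finset.sum_comm, ← Equiv.sum_comp (Equiv.mulLeft τ)]
    rfl
  have h3 : l2sq v = ∑ τ : Equiv.Perm (Fin t), l2sq fun r => φ (x ∘ τ, r) := by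
    unfold l2sq
    rw [← Fintype.sum_of_injective e he (fun p => ‖v (e p)‖ ^ 2) _
      (fun q hq => by simp [hv0 q hq]) fun p => rfl]
    simp only [Fintype.sum_prod_type, hv]
  rw [← h1, ← h3]
  refine (hW v v).trans (le_of_eq (Real.mul_self_sqrt (l2sq_nonneg _)))

/-- Shifting `x` and `x'` by a common `τ` leaves the sum unchanged. Averaging over `τ` groups the
blocks into whole orbits, to which `norm_sum_blockForm_perm_le` applies. -/
theorem norm_meanForm_le {W : Matrix ((Fin t → ι) × η) ((Fin t → ι) × η) ℂ}
    (hW : IsContraction W) (φ : (Fin t → ι) × η → ℂ) : ‖meanForm W φ‖ ≤ l2sq φ := by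
  set N : ℕ := (Fintype.card ι).descFactorial t with hN
  set S : ℂ := ∑ x : Fin t → ι, ∑ σ : Equiv.Perm (Fin t), ∑ x' : Fin t ↪ ι,
    blockForm W φ x x' σ with hS
  have hshift : ∀ τ : Equiv.Perm (Fin t), S = ∑ x : Fin t → ι, ∑ x' : Fin t ↪ ι,
      ∑ σ : Equiv.Perm (Fin t), blockForm W φ (x ∘ τ) (x' ∘ τ) σ := by
    intro τ
    let e : (Fin t ↪ ι) ≃ (Fin t ↪ ι) := Equiv.embeddingCongr τ.symm (Equiv.refl ι)
    rw [hS, ← (permuteTuple τ).sum_comp]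
    refine Finset.sum_congr rfl fun x _ => ?_
    rw [Finset.sum_comm, ← e.sum_comp]
    rfl
  have hsum : (t.factorial : ℂ) * S = ∑ x : Fin t → ι, ∑ x' : Fin t ↪ ι,
      ∑ τ : Equiv.Perm (Fin t), ∑ σ : Equiv.Perm (Fin t),
        blockForm W φ (x ∘ τ) (x' ∘ τ) σ := by
    have h1 : (t.factorial : ℂ) * S = ∑ _τ : Equiv.Perm (Fin t), S := by
      rw [Finset.sum_const, Finset.card_univ, Fintype.card_perm, Fintype.card_fin, nsmul_eq_mul]
    rw [h1, Finset.sum_congr rfl fun τ _ => hshift τ, Finset.sum_comm]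
    exact Finset.sum_congr rfl fun x _ => Finset.sum_comm
  have hbound : (t.factorial : ℝ) * ‖S‖ ≤ t.factorial * (N * l2sq φ) := by
    calc (t.factorial : ℝ) * ‖S‖ = ‖(t.factorial : ℂ) * S‖ := by simp
      _ ≤ ∑ x : Fin t → ι, ∑ _x' : Fin t ↪ ι, ∑ τ : Equiv.Perm (Fin t),
          l2sq fun r => φ (x ∘ τ, r) := by
          rw [hsum]
          refine (norm_sum_le _ _).trans (Finset.sum_le_sum fun x _ => ?_)
          refine (norm_sum_le _ _).trans (Finset.sum_le_sum fun x' _ => ?_)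
          exact norm_sum_blockForm_perm_le hW φ x x'
      _ = N * ∑ τ : Equiv.Perm (Fin t), ∑ x : Fin t → ι, l2sq fun r => φ (x ∘ τ, r) := by
          simp only [Finset.sum_const, Finset.card_univ, Fintype.card_embedding_eq,
            Fintype.card_fin, nsmul_eq_mul, ← Finset.mul_sum]
          rw [Finset.sum_comm]
      _ = N * ∑ _τ : Equiv.Perm (Fin t), l2sq φ := by
          congr 1
          refine Finset.sum_congr rfl fun τ _ => ?_
          rw [l2sq_eq_sum_l2sq_fst]
          exact (permuteTuple τ).sum_comp fun x : Fin t → ι => l2sq fun r => φ (x, r)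
      _ = t.factorial * (N * l2sq φ) := by
          rw [Finset.sum_const, Finset.card_univ, Fintype.card_perm, Fintype.card_fin,
            nsmul_eq_mul]
          ring
  have hS' : ‖S‖ ≤ N * l2sq φ := le_of_mul_le_mul_left hbound (by positivity)
  rw [meanForm, norm_mul, norm_inv, Complex.norm_natCast, ← hS]
  calc (N : ℝ)⁻¹ * ‖S‖ ≤ (N : ℝ)⁻¹ * (N * l2sq φ) :=
        mul_le_mul_of_nonneg_left hS' (by positivity)
    _ = ((N : ℝ)⁻¹ * N) * l2sq φ := by ring
    _ ≤ l2sq φ := mul_le_of_le_one_left (l2sq_nonneg _) (inv_mul_le_one)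

theorem tensorPow_mulVec_comp_perm (U : Matrix ι ι ℂ) (u : (Fin t → ι) → ℂ)
    (σ : Equiv.Perm (Fin t)) (x : Fin t → ι) :
    (tensorPow t U *ᵥ u) (x ∘ σ) = (tensorPow t U *ᵥ fun y => u (y ∘ σ)) x := by
  simp only [Matrix.mulVec, dotProduct, tensorPow, Matrix.of_apply]
  rw [← (permuteTuple σ).sum_comp]
  refine Finset.sum_congr rfl fun a _ => ?_
  rw [permuteTuple_apply]
  congr 1
  exact Equiv.prod_comp σ fun i => U (x i) (a i)

/-- `meanForm` depends on `φ` only through its correlations with permuted copies, which local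
unitaries `U^{⊗ t}` preserve. -/
theorem meanForm_tensorAct [DecidableEq ι] (W : Matrix ((Fin t → ι) × η) ((Fin t → ι) × η) ℂ)
    (U : Matrix.unitaryGroup ι ℂ) (φ : (Fin t → ι) × η → ℂ) :
    meanForm W (tensorAct (U : Matrix ι ι ℂ) φ) = meanForm W φ := by
  have h : ∀ χ : (Fin t → ι) × η → ℂ,
      ∑ x : Fin t → ι, ∑ σ : Equiv.Perm (Fin t), ∑ x' : Fin t ↪ ι, blockForm W χ x x' σ =
      ∑ σ : Equiv.Perm (Fin t), ∑ x' : Fin t ↪ ι, ∑ r, ∑ s, W (x', r) (x' ∘ σ, s) *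
        (star (fun x => χ (x, r)) ⬝ᵥ fun x => χ (x ∘ σ, s)) := by
    intro χ
    simp only [blockForm, dotProduct, Finset.mul_sum, Pi.star_apply]
    rw [Finset.sum_comm]
    refine Finset.sum_congr rfl fun σ _ => ?_
    rw [Finset.sum_comm]
    refine Finset.sum_congr rfl fun x' _ => ?_
    rw [Finset.sum_comm]
    refine Finset.sum_congr rfl fun r _ => ?_
    rw [Finset.sum_comm]
    exact Finset.sum_congr rfl fun s _ => Finset.sum_congr rfl fun x _ => by ring
  unfold meanForm
  rw [h, h]
  refine congrArg _ (Finset.sum_congr rfl fun σ _ => Finset.sum_congr rfl fun x' _ =>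
    Finset.sum_congr rfl fun r _ => Finset.sum_congr rfl fun s _ => congrArg _ ?_)
  have h1 : (fun x => tensorAct (U : Matrix ι ι ℂ) φ (x ∘ σ, s)) =
      tensorPow t (U : Matrix ι ι ℂ) *ᵥ fun x => φ (x ∘ σ, s) :=
    funext fun x => tensorPow_mulVec_comp_perm _ (fun x => φ (x, s)) σ x
  have h2 : (fun x => tensorAct (U : Matrix ι ι ℂ) φ (x, r)) =
      tensorPow t (U : Matrix ι ι ℂ) *ᵥ fun x => φ (x, r) := rfl
  rw [h1, h2, Matrix.star_mulVec, ← Matrix.dotProduct_mulVec, Matrix.mulVec_mulVec,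
    tensorPow_conjTranspose_mul_self, Matrix.one_mulVec]

end MeanForm

/-! ### Clifford unitaries from quadratic phases and the Hadamard gate. -/

section Clifford

variable {n : ℕ}

theorem mem_cliffordGroup_of_forall_pauliMatrix {U : Matrix.unitaryGroup (Bits n) ℂ}
    (h : ∀ a b : Bits n, ∃ (k : ℕ) (c e : Bits n), (U : Matrix (Bits n) (Bits n) ℂ) *
      pauliMatrix a b = Complex.I ^ k • (pauliMatrix c e * (U : Matrix (Bits n) (Bits n) ℂ))) :
    U ∈ cliffordGroup n := by
  have hfin : Finite (pauliGroup n : Set (Matrix.unitaryGroup (Bits n) ℂ)) :=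
    (finite_pauliGroup n).to_subtype
  -- For a finite subgroup, one inclusion under conjugation already gives normalization.
  refine Subgroup.mem_normalizer_fintype fun P hP => ?_
  obtain ⟨l, a, b, hP⟩ := hP
  obtain ⟨k, c, e, h⟩ := h a b
  refine ⟨l + k, c, e, ?_⟩
  have hU : (U : Matrix (Bits n) (Bits n) ℂ) *
      ((U⁻¹ : Matrix.unitaryGroup (Bits n) ℂ) : Matrix (Bits n) (Bits n) ℂ) = 1 := by
    rw [← Matrix.UnitaryGroup.mul_val, mul_inv_cancel, Matrix.UnitaryGroup.one_val]
  rw [Matrix.UnitaryGroup.mul_val, Matrix.UnitaryGroup.mul_val, hP, Matrix.mul_smul, h, smul_smul,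
    Matrix.smul_mul, Matrix.mul_assoc, hU, Matrix.mul_one, pow_add]

/-- The character `k ↦ i^k` of `ℤ/4`. -/
def iPow (k : ZMod 4) : ℂ := Complex.I ^ k.val

theorem iPow_add (k l : ZMod 4) : iPow (k + l) = iPow k * iPow l := by
  have h : ∀ k l : ZMod 4, (k + l).val % 4 = (k.val + l.val) % 4 := by decide
  rw [iPow, iPow, iPow, ← pow_add, Complex.I_pow_eq_pow_mod, h, ← Complex.I_pow_eq_pow_mod]

theorem iPow_zero : iPow 0 = 1 := pow_zero _

theorem norm_iPow (k : ZMod 4) : ‖iPow k‖ = 1 := by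
  rw [iPow, norm_pow, Complex.norm_I, one_pow]

theorem star_iPow (k : ZMod 4) : star (iPow k) = iPow (-k) := by
  have h1 : iPow (-k) * iPow k = 1 := by rw [← iPow_add, neg_add_cancel, iPow_zero]
  have h2 : star (iPow k) * iPow k = 1 := by
    rw [Complex.star_def, ← Complex.normSq_eq_conj_mul_self, Complex.normSq_eq_norm_sq, norm_iPow]
    simp
  have h3 : iPow k ≠ 0 := by
    rw [← norm_ne_zero_iff, norm_iPow]
    exact one_ne_zero
  exact mul_right_cancel₀ h3 (h2.trans h1.symm)

theorem iPow_ne_one {k : ZMod 4} (hk : k ≠ 0) : iPow k ≠ 1 := by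
  have h : ∀ k : ZMod 4, k ≠ 0 → k.val = 1 ∨ k.val = 2 ∨ k.val = 3 := by decide
  rcases h k hk with h | h | h <;> rw [iPow, h] <;> norm_num [Complex.ext_iff, Complex.I_pow_three]

/-- The lift of a bit to `{0, 1} ⊆ ℤ/4`. -/
def liftBit (u : ZMod 2) : ZMod 4 := u.val

theorem iPow_two_mul_liftBit (u : ZMod 2) : iPow (2 * liftBit u) = (-1) ^ u.val := by
  have h : ∀ u : ZMod 2, (2 * liftBit u).val = 2 * u.val := by decide
  rw [iPow, h, pow_mul, Complex.I_sq]

theorem liftBit_add (u v : ZMod 2) :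
    liftBit (u + v) = liftBit u + liftBit v + 2 * liftBit (u * v) := by
  revert u v; decide

theorem two_mul_liftBit_add (u v : ZMod 2) :
    2 * liftBit (u + v) = 2 * liftBit u + 2 * liftBit v := by
  revert u v; decide

theorem two_mul_liftBit_neg (u : ZMod 2) : 2 * liftBit u = -(2 * liftBit u) := by
  revert u; decide

/-- The exponents `g` for which `|x⟩ ↦ i^{g(x)} |x⟩` conjugates Pauli operators to Pauli
operators. -/
def quadraticPhases (n : ℕ) : AddSubgroup (Bits n → ZMod 4) where
  carrier := {g | ∀ a, ∃ (k : ZMod 4) (c : Bits n), ∀ x,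
    g (x + a) = g x + k + 2 * liftBit (c ⬝ᵥ x)}
  zero_mem' := fun a => ⟨0, 0, fun x => by simp [liftBit]⟩
  add_mem' := by
    intro g g' hg hg' a
    obtain ⟨k, c, h⟩ := hg a
    obtain ⟨k', c', h'⟩ := hg' a
    refine ⟨k + k', c + c', fun x => ?_⟩
    rw [Pi.add_apply, Pi.add_apply, h, h', add_dotProduct, two_mul_liftBit_add]
    ring
  neg_mem' := by
    intro g hg a
    obtain ⟨k, c, h⟩ := hg a
    refine ⟨-k, c, fun x => ?_⟩
    rw [Pi.neg_apply, Pi.neg_apply, h]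
    linear_combination -two_mul_liftBit_neg (c ⬝ᵥ x)

/-- The exponent of the phase gate on qubit `i`. -/
theorem liftBit_mem_quadraticPhases (i : Fin n) :
    (fun x : Bits n => liftBit (x i)) ∈ quadraticPhases n := fun a =>
  ⟨liftBit (a i), Pi.single i (a i), fun x => by
    beta_reduce
    rw [Pi.add_apply, liftBit_add, single_dotProduct, mul_comm (x i)]⟩

/-- The exponent of the controlled-`Z` gate on qubits `i` and `j`. -/
theorem two_mul_liftBit_mul_mem_quadraticPhases (i j : Fin n) :
    (fun x : Bits n => 2 * liftBit (x i * x j)) ∈ quadraticPhases n := fun a =>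
  ⟨2 * liftBit (a i * a j), Pi.single j (a i) + Pi.single i (a j), fun x => by
    beta_reduce
    rw [Pi.add_apply, Pi.add_apply, add_dotProduct, single_dotProduct, single_dotProduct,
      show (x i + a i) * (x j + a j) = x i * x j + a i * a j + (a i * x j + a j * x i) by ring,
      two_mul_liftBit_add, two_mul_liftBit_add (x i * x j)]⟩

/-- The quadratic phases separate unordered pairs of bit strings. -/
theorem eq_or_eq_of_forall_quadraticPhases {y₁ y₂ z₁ z₂ : Bits n}
    (h : ∀ g ∈ quadraticPhases n, g z₁ + g z₂ - (g y₁ + g y₂) = 0) :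
    (z₁ = y₁ ∧ z₂ = y₂) ∨ (z₁ = y₂ ∧ z₂ = y₁) := by
  have h1 : ∀ i, liftBit (z₁ i) + liftBit (z₂ i) = liftBit (y₁ i) + liftBit (y₂ i) := fun i =>
    sub_eq_zero.mp (h _ (liftBit_mem_quadraticPhases i))
  have h2 : ∀ i j, 2 * liftBit (z₁ i * z₁ j) + 2 * liftBit (z₂ i * z₂ j) =
      2 * liftBit (y₁ i * y₁ j) + 2 * liftBit (y₂ i * y₂ j) := fun i j =>
    sub_eq_zero.mp (h _ (two_mul_liftBit_mul_mem_quadraticPhases i j))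
  have key1 : ∀ y z w : ZMod 2, liftBit y + liftBit w = liftBit y + liftBit z → w = z := by decide
  -- At a position where `z₁` and `y₁` differ, the bit counts force the pair to be swapped; the
  -- products with any other position then propagate the swap to it.
  have key2 : ∀ y z u v y' z' u' v' : ZMod 2, u ≠ y → liftBit u + liftBit v = liftBit y + liftBit z →
      liftBit u' + liftBit v' = liftBit y' + liftBit z' →
      2 * liftBit (u * u') + 2 * liftBit (v * v') = 2 * liftBit (y * y') + 2 * liftBit (z * z') →
      u' = z' ∧ v' = y' := by decide
  by_cases hzy : z₁ = y₁
  · subst hzy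
    exact Or.inl ⟨rfl, funext fun i => key1 _ _ _ (h1 i)⟩
  · obtain ⟨i, hi⟩ := Function.ne_iff.mp hzy
    exact Or.inr ⟨funext fun j => (key2 _ _ _ _ _ _ _ _ hi (h1 i) (h1 j) (h2 i j)).1,
      funext fun j => (key2 _ _ _ _ _ _ _ _ hi (h1 i) (h1 j) (h2 i j)).2⟩

/-- Orthogonality: the sum of a nontrivial character over a finite group vanishes. -/
theorem sum_iPow_quadraticPhases [Fintype (quadraticPhases n)] {y₁ y₂ z₁ z₂ : Bits n}
    (h : ¬ ((z₁ = y₁ ∧ z₂ = y₂) ∨ (z₁ = y₂ ∧ z₂ = y₁))) :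
    ∑ g : quadraticPhases n, iPow (g.1 z₁ + g.1 z₂ - (g.1 y₁ + g.1 y₂)) = 0 := by
  have hex : ∃ g ∈ quadraticPhases n, g z₁ + g z₂ - (g y₁ + g y₂) ≠ 0 := by
    by_contra! h'
    exact h (eq_or_eq_of_forall_quadraticPhases h')
  obtain ⟨g₀, hg₀, hne⟩ := hex
  set S := ∑ g : quadraticPhases n, iPow (g.1 z₁ + g.1 z₂ - (g.1 y₁ + g.1 y₂)) with hS
  have hshift : S = iPow (g₀ z₁ + g₀ z₂ - (g₀ y₁ + g₀ y₂)) * S := by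
    conv_lhs => rw [hS, ← Equiv.sum_comp (Equiv.addRight (⟨g₀, hg₀⟩ : quadraticPhases n))]
    rw [hS, Finset.mul_sum]
    refine Finset.sum_congr rfl fun g _ => ?_
    rw [← iPow_add]
    congr 1
    simp only [Equiv.coe_addRight, AddSubgroup.coe_add, Pi.add_apply]
    ring
  have h1 : (1 - iPow (g₀ z₁ + g₀ z₂ - (g₀ y₁ + g₀ y₂))) * S = 0 := by
    rw [sub_mul, one_mul, ← hshift, sub_self]
  rcases mul_eq_zero.mp h1 with h2 | h2
  · exact absurd (sub_eq_zero.mp h2).symm (iPow_ne_one hne)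
  · exact h2

/-- The diagonal unitary `|x⟩ ↦ i^{g(x)} |x⟩`. -/
def diagonalPhase (g : Bits n → ZMod 4) : Matrix.unitaryGroup (Bits n) ℂ :=
  ⟨Matrix.diagonal fun x => iPow (g x), by
    rw [Matrix.mem_unitaryGroup_iff', Matrix.star_eq_conjTranspose, Matrix.diagonal_conjTranspose,
      Matrix.diagonal_mul_diagonal, ← Matrix.diagonal_one]
    congr 1
    funext x
    rw [Pi.star_apply, star_iPow, ← iPow_add, neg_add_cancel, iPow_zero]⟩

theorem diagonalPhase_mem_cliffordGroup {g : Bits n → ZMod 4} (hg : g ∈ quadraticPhases n) :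
    diagonalPhase g ∈ cliffordGroup n := by
  refine mem_cliffordGroup_of_forall_pauliMatrix fun a b => ?_
  obtain ⟨k, c, h⟩ := hg a
  -- Conjugation fixes `X^a` up to the discrete derivative of `g` along `a`, which is affine and so
  -- supplies the scalar `i^k` and the factor `Z^c`.
  refine ⟨k.val, a, b + c, ?_⟩
  ext y x
  simp only [diagonalPhase, Matrix.diagonal_mul, Matrix.smul_apply, Matrix.mul_diagonal,
    pauliMatrix, Matrix.of_apply, smul_eq_mul]
  by_cases hy : y = x + a
  · rw [if_pos hy, if_pos hy, hy, h, iPow_add, iPow_add, iPow_two_mul_liftBit, add_dotProduct,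
      neg_one_pow_val_add, iPow, iPow]
    ring
  · rw [if_neg hy, if_neg hy]
    ring

theorem sum_neg_one_pow_dotProduct (x : Bits n) :
    ∑ w : Bits n, (-1 : ℂ) ^ (w ⬝ᵥ x).val = if x = 0 then 2 ^ n else 0 := by
  split_ifs with h
  · simp [h]
  · obtain ⟨i, hi⟩ := Function.ne_iff.mp h
    set S := ∑ w : Bits n, (-1 : ℂ) ^ (w ⬝ᵥ x).val with hS
    have hone : x i = 1 := by
      have : ∀ u : ZMod 2, u ≠ 0 → u = 1 := by decide
      exact this _ hi
    have hshift : S = -S := by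
      conv_lhs => rw [hS, ← Equiv.sum_comp (Equiv.addRight (Pi.single i 1 : Bits n))]
      rw [hS, ← Finset.sum_neg_distrib]
      refine Finset.sum_congr rfl fun w _ => ?_
      rw [Equiv.coe_addRight, add_dotProduct, single_dotProduct, hone, neg_one_pow_val_add]
      simp [ZMod.val_one]
    exact self_eq_neg.mp hshift

/-- The `n`-qubit Hadamard gate `H^{⊗ n}`. -/
def hadamardGate (n : ℕ) : Matrix.unitaryGroup (Bits n) ℂ :=
  ⟨Matrix.of fun y x => ((√((2 : ℝ) ^ n))⁻¹ : ℝ) * (-1) ^ (y ⬝ᵥ x).val, by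
    rw [Matrix.mem_unitaryGroup_iff']
    ext x y
    have h : ∀ w : Bits n, star ((((√((2 : ℝ) ^ n))⁻¹ : ℝ) : ℂ) * (-1) ^ (w ⬝ᵥ x).val) *
        ((((√((2 : ℝ) ^ n))⁻¹ : ℝ) : ℂ) * (-1) ^ (w ⬝ᵥ y).val) =
        ((2 : ℂ) ^ n)⁻¹ * (-1) ^ (w ⬝ᵥ (x + y)).val := by
      intro w
      have h1 : (((√((2 : ℝ) ^ n))⁻¹ : ℝ) : ℂ) * (((√((2 : ℝ) ^ n))⁻¹ : ℝ) : ℂ) =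
          ((2 : ℂ) ^ n)⁻¹ := by
        rw [← Complex.ofReal_mul, ← mul_inv, Real.mul_self_sqrt (by positivity)]
        push_cast
        rfl
      rw [dotProduct_add, neg_one_pow_val_add, ← h1]
      simp
      ring
    simp only [Matrix.mul_apply, Matrix.star_apply, Matrix.of_apply, h, ← Finset.mul_sum,
      sum_neg_one_pow_dotProduct, Matrix.one_apply]
    have h2 : x + y = 0 ↔ x = y := by
      rw [← bits_add_self y, add_left_inj]
    simp only [h2]
    split_ifs
    · exact inv_mul_cancel₀ (pow_ne_zero n two_ne_zero)
    · exact mul_zero _⟩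

theorem hadamardGate_mem_cliffordGroup : hadamardGate n ∈ cliffordGroup n := by
  -- Hadamard exchanges `X` and `Z`; the sign `(-1)^{a·b}` comes from reordering `Z^a X^b`.
  refine mem_cliffordGroup_of_forall_pauliMatrix fun a b => ⟨2 * (a ⬝ᵥ b).val, b, a, ?_⟩
  ext y x
  simp only [hadamardGate, Matrix.mul_apply, Matrix.smul_apply, pauliMatrix, Matrix.of_apply,
    smul_eq_mul]
  rw [Finset.sum_eq_single (x + a) (fun w _ hw => by rw [if_neg hw, mul_zero]) (by simp),
    Finset.sum_eq_single (y + b) (fun w _ hw => by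
      rw [if_neg fun h => hw (by rw [h, add_assoc, bits_add_self, add_zero]), zero_mul]) (by simp),
    if_pos rfl, if_pos (by rw [add_assoc, bits_add_self, add_zero]), pow_mul, Complex.I_sq,
    dotProduct_add, dotProduct_add, add_dotProduct, neg_one_pow_val_add, neg_one_pow_val_add,
    neg_one_pow_val_add, dotProduct_comm a y]
  linear_combination -(((√((2 : ℝ) ^ n))⁻¹ : ℝ) : ℂ) * (-1) ^ (y ⬝ᵥ x).val * (-1) ^ (y ⬝ᵥ a).val *
    (-1) ^ (b ⬝ᵥ x).val * neg_one_pow_val_mul_self (a ⬝ᵥ b)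

end Clifford

/-! ### Weight on tuples with a repeated label. -/

section Collision

variable {ι η : Type*} [Fintype ι] [DecidableEq ι] [Fintype η] {t : ℕ}

/-- The weight of `φ` on tuples whose labels at positions `i` and `j` agree. -/
def collisionWeight (i j : Fin t) (φ : (Fin t → ι) × η → ℂ) : ℝ :=
  ∑ p, if p.1 i = p.1 j then ‖φ p‖ ^ 2 else 0

theorem collisionWeight_nonneg (i j : Fin t) (φ : (Fin t → ι) × η → ℂ) :
    0 ≤ collisionWeight i j φ :=
  Finset.sum_nonneg fun p _ => by split_ifs <;> positivity

theorem l2sq_sub_distinctPart_le (φ : (Fin t → ι) × η → ℂ) :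
    l2sq (φ - distinctPart φ) ≤
      ∑ i, ∑ j, if i ≠ j then collisionWeight i j φ else 0 := by
  classical
  have h1 : ∀ i j : Fin t, (if i ≠ j then collisionWeight i j φ else 0) =
      ∑ p : (Fin t → ι) × η, if i ≠ j ∧ p.1 i = p.1 j then ‖φ p‖ ^ 2 else 0 := by
    intro i j
    by_cases h : i = j <;> simp [h, collisionWeight]
  simp only [h1]
  rw [Finset.sum_congr rfl fun i _ => Finset.sum_comm, Finset.sum_comm]
  refine Finset.sum_le_sum fun p _ => ?_
  have hnn : ∀ i j : Fin t, 0 ≤ if i ≠ j ∧ p.1 i = p.1 j then ‖φ p‖ ^ 2 else 0 := fun i j => by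
    split_ifs <;> positivity
  by_cases hp : Function.Injective p.1
  · simp only [Pi.sub_apply, distinctPart, if_pos hp, sub_self, norm_zero]
    rw [zero_pow two_ne_zero]
    exact Finset.sum_nonneg fun i _ => Finset.sum_nonneg fun j _ => hnn i j
  · simp only [Pi.sub_apply, distinctPart, if_neg hp, sub_zero]
    simp only [Function.Injective, not_forall] at hp
    obtain ⟨i, j, hij, hne⟩ := hp
    calc ‖φ p‖ ^ 2 = if i ≠ j ∧ p.1 i = p.1 j then ‖φ p‖ ^ 2 else 0 := by rw [if_pos ⟨hne, hij⟩]
      _ ≤ ∑ j, if i ≠ j ∧ p.1 i = p.1 j then ‖φ p‖ ^ 2 else 0 :=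
          Finset.single_le_sum (f := fun j => if i ≠ j ∧ p.1 i = p.1 j then ‖φ p‖ ^ 2 else 0)
            (fun j _ => hnn i j) (Finset.mem_univ j)
      _ ≤ _ := Finset.single_le_sum
            (f := fun i => ∑ j, if i ≠ j ∧ p.1 i = p.1 j then ‖φ p‖ ^ 2 else 0)
            (fun i _ => Finset.sum_nonneg fun j _ => hnn i j) (Finset.mem_univ i)

/-- The kernel of the pulled back collision projector. -/
def collisionKernel (i j : Fin t) (V : Matrix ι ι ℂ) (y z : Fin t → ι) : ℂ :=
  ∑ x : Fin t → ι, if x i = x j then star (tensorPow t V x y) * tensorPow t V x z else 0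

theorem collisionWeight_tensorAct (i j : Fin t) (V : Matrix ι ι ℂ) (φ : (Fin t → ι) × η → ℂ) :
    (collisionWeight i j (tensorAct V φ) : ℂ) =
      ∑ r, ∑ y, ∑ z, star (φ (y, r)) * φ (z, r) * collisionKernel i j V y z := by
  unfold collisionWeight collisionKernel
  rw [Fintype.sum_prod_type_right, Complex.ofReal_sum]
  refine Finset.sum_congr rfl fun r _ => ?_
  rw [Complex.ofReal_sum]
  simp only [Finset.mul_sum]
  rw [Finset.sum_congr rfl fun y _ => Finset.sum_comm, Finset.sum_comm]
  refine Finset.sum_congr rfl fun x _ => ?_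
  split_ifs
  · rw [← Complex.normSq_eq_norm_sq, Complex.normSq_eq_conj_mul_self, ← Complex.star_def]
    simp only [tensorAct, Matrix.mulVec, dotProduct, star_sum, star_mul', Finset.sum_mul_sum]
    exact Finset.sum_congr rfl fun y _ => Finset.sum_congr rfl fun z _ => by ring
  · simp

/-- At positions other than `i` and `j` the label is summed freely, and orthonormality of the
columns forces `y k = z k`. Positions `i` and `j` share one label `w`. -/
theorem collisionKernel_eq {i j : Fin t} (hij : i ≠ j) (V : Matrix.unitaryGroup ι ℂ)
    (y z : Fin t → ι) :
    collisionKernel i j (V : Matrix ι ι ℂ) y z =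
      if ∀ k, k ≠ i ∧ k ≠ j → y k = z k then
        ∑ w, star (V.1 w (y i)) * V.1 w (z i) * (star (V.1 w (y j)) * V.1 w (z j)) else 0 := by
  classical
  -- Naming the common label `w` turns the collision condition into a product over positions, so
  -- that the sum over tuples factorises.
  have hind : ∀ x : Fin t → ι, (if x i = x j then star (tensorPow t (V : Matrix ι ι ℂ) x y) *
      tensorPow t (V : Matrix ι ι ℂ) x z else 0) =
      ∑ w, ∏ k, (if k = i ∨ k = j then (if x k = w then (1 : ℂ) else 0) else 1) *
        (star (V.1 (x k) (y k)) * V.1 (x k) (z k)) := by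
    intro x
    have h1 : ∀ w, (∏ k, if k = i ∨ k = j then (if x k = w then (1 : ℂ) else 0) else 1) =
        if x i = w then (if x j = w then 1 else 0) else 0 := by
      intro w
      rw [Fintype.prod_eq_mul i j hij fun k hk => by rw [if_neg (by tauto)]]
      by_cases h2 : x i = w <;> simp [h2]
    simp only [Finset.prod_mul_distrib, h1, ← Finset.sum_mul]
    rw [Finset.sum_ite_eq]
    simp only [Finset.mem_univ, if_true, tensorPow, Matrix.of_apply, star_prod, eq_comm (a := x j)]
    split_ifs <;> simp
  have hunit : ∀ a b : ι, ∑ v, star (V.1 v a) * V.1 v b = if a = b then 1 else 0 := by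
    intro a b
    have h := congrFun (congrFun (Matrix.mem_unitaryGroup_iff'.mp V.2) a) b
    simpa only [Matrix.mul_apply, Matrix.star_apply, Matrix.one_apply] using h
  unfold collisionKernel
  rw [Finset.sum_congr rfl fun x _ => hind x, Finset.sum_comm]
  have hprod : ∀ w, ∑ x : Fin t → ι, ∏ k, (if k = i ∨ k = j then
      (if x k = w then (1 : ℂ) else 0) else 1) * (star (V.1 (x k) (y k)) * V.1 (x k) (z k)) =
      ∏ k, if k = i ∨ k = j then star (V.1 w (y k)) * V.1 w (z k)
        else if y k = z k then 1 else 0 := by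
    intro w
    have h := Finset.prod_univ_sum (fun _ : Fin t => (Finset.univ : Finset ι))
      (fun k v => (if k = i ∨ k = j then (if v = w then (1 : ℂ) else 0) else 1) *
        (star (V.1 v (y k)) * V.1 v (z k)))
    rw [Fintype.piFinset_univ] at h
    rw [← h]
    refine Finset.prod_congr rfl fun k _ => ?_
    by_cases hk : k = i ∨ k = j
    · simp [hk]
    · simp only [if_neg hk, one_mul, hunit]
  simp only [hprod]
  split_ifs with h
  · refine Finset.sum_congr rfl fun w _ => ?_
    rw [Fintype.prod_eq_mul i j hij fun k hk => by rw [if_neg (by tauto), if_pos (h k hk)]]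
    simp
  · push Not at h
    obtain ⟨k, hk, hne⟩ := h
    refine Finset.sum_eq_zero fun w _ => Finset.prod_eq_zero (Finset.mem_univ k) ?_
    rw [if_neg (by tauto), if_neg hne]

end Collision

/-! ### Collision weight averaged over Clifford unitaries. -/

section CliffordCollision

variable {n t : ℕ}

/-- The Clifford unitary `H^{⊗ n}` after a diagonal phase. -/
def hadamardPhase (g : Bits n → ZMod 4) : Matrix.unitaryGroup (Bits n) ℂ :=
  hadamardGate n * diagonalPhase g

theorem hadamardPhase_apply (g : Bits n → ZMod 4) (w y : Bits n) :
    (hadamardPhase g).1 w y = ((√((2 : ℝ) ^ n))⁻¹ : ℝ) * (-1) ^ (w ⬝ᵥ y).val * iPow (g y) := by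
  simp only [hadamardPhase, hadamardGate, diagonalPhase, Matrix.UnitaryGroup.mul_val,
    Matrix.mul_diagonal, Matrix.of_apply]

/-- The phase average forces `{z i, z j} = {y i, y j}` as unordered pairs, which leaves `z = y` and
its transposition. -/
theorem norm_sum_collisionKernel_le [Fintype (quadraticPhases n)] {i j : Fin t} (hij : i ≠ j)
    (y z : Fin t → Bits n) :
    ‖∑ g : quadraticPhases n,
        collisionKernel i j (hadamardPhase g.1 : Matrix (Bits n) (Bits n) ℂ) y z‖ ≤
      if z = y ∨ z = y ∘ Equiv.swap i j then
        Fintype.card (quadraticPhases n) * ((2 : ℝ) ^ n)⁻¹ else 0 := by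
  have hd : (0 : ℝ) < 2 ^ n := by positivity
  set c : Bits n → ℂ := fun w => (((√((2 : ℝ) ^ n))⁻¹ : ℝ) : ℂ) ^ 4 * ((-1) ^ (w ⬝ᵥ y i).val *
    (-1) ^ (w ⬝ᵥ z i).val * (-1) ^ (w ⬝ᵥ y j).val * (-1) ^ (w ⬝ᵥ z j).val) with hc
  have hker : ∀ g : quadraticPhases n,
      collisionKernel i j (hadamardPhase g.1 : Matrix (Bits n) (Bits n) ℂ) y z =
      if ∀ k, k ≠ i ∧ k ≠ j → y k = z k then
        (∑ w, c w) * iPow (g.1 (z i) + g.1 (z j) - (g.1 (y i) + g.1 (y j))) else 0 := by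
    intro g
    rw [collisionKernel_eq hij]
    congr 1
    rw [Finset.sum_mul]
    refine Finset.sum_congr rfl fun w _ => ?_
    rw [hadamardPhase_apply, hadamardPhase_apply, hadamardPhase_apply, hadamardPhase_apply,
      show g.1 (z i) + g.1 (z j) - (g.1 (y i) + g.1 (y j)) =
        g.1 (z i) + g.1 (z j) + (-g.1 (y i) + -g.1 (y j)) by ring, iPow_add, iPow_add, iPow_add,
      ← star_iPow, ← star_iPow, hc]
    simp
    ring
  simp only [hker]
  -- There are `d` terms, each a product of four Hadamard entries and so of modulus `d⁻²`.
  have hcn : ‖∑ w, c w‖ ≤ ((2 : ℝ) ^ n)⁻¹ := by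
    refine (norm_sum_le _ _).trans (le_of_eq ?_)
    have h1 : ∀ w, ‖c w‖ = ((2 : ℝ) ^ n)⁻¹ * ((2 : ℝ) ^ n)⁻¹ := by
      intro w
      have h2 : (√((2 : ℝ) ^ n))⁻¹ ^ 4 = ((2 : ℝ) ^ n)⁻¹ * ((2 : ℝ) ^ n)⁻¹ := by
        rw [inv_pow, show 4 = 2 * 2 from rfl, pow_mul, Real.sq_sqrt hd.le, sq, mul_inv]
      rw [← h2]
      simp [hc, abs_of_nonneg]
    simp only [h1, Finset.sum_const, Finset.card_univ, nsmul_eq_mul]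
    simp
  have hnn : (0 : ℝ) ≤ if z = y ∨ z = y ∘ Equiv.swap i j then
      Fintype.card (quadraticPhases n) * ((2 : ℝ) ^ n)⁻¹ else 0 := by
    split_ifs <;> positivity
  by_cases hk : ∀ k, k ≠ i ∧ k ≠ j → y k = z k
  swap
  · simpa only [if_neg hk, Finset.sum_const_zero, norm_zero] using hnn
  simp only [if_pos hk, ← Finset.mul_sum]
  by_cases hpair : (z i = y i ∧ z j = y j) ∨ (z i = y j ∧ z j = y i)
  swap
  · simpa only [sum_iPow_quadraticPhases hpair, mul_zero, norm_zero] using hnn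
  have hz : z = y ∨ z = y ∘ Equiv.swap i j := by
    rcases hpair with h | h
    · refine Or.inl (funext fun k => ?_)
      by_cases h1 : k = i
      · rw [h1, h.1]
      by_cases h2 : k = j
      · rw [h2, h.2]
      exact (hk k ⟨h1, h2⟩).symm
    · refine Or.inr (funext fun k => ?_)
      rw [Function.comp_apply]
      by_cases h1 : k = i
      · rw [h1, h.1, Equiv.swap_apply_left]
      by_cases h2 : k = j
      · rw [h2, h.2, Equiv.swap_apply_right]
      rw [Equiv.swap_apply_of_ne_of_ne h1 h2]
      exact (hk k ⟨h1, h2⟩).symm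
  rw [if_pos hz, norm_mul, mul_comm]
  refine mul_le_mul ?_ hcn (norm_nonneg _) (by positivity)
  refine (norm_sum_le _ _).trans (le_of_eq ?_)
  simp [norm_iPow]

variable {η : Type*} [Fintype η]

/-- The averaged kernel is dominated by `1 / d` times the identity plus a transposition of
positions. Each contributes at most `l2sq φ`, the second by Cauchy–Schwarz. -/
theorem sum_collisionWeight_hadamardPhase_le [Fintype (quadraticPhases n)] {i j : Fin t}
    (hij : i ≠ j) (φ : (Fin t → Bits n) × η → ℂ) :
    ∑ g : quadraticPhases n, collisionWeight i j
        (tensorAct (hadamardPhase g.1 : Matrix (Bits n) (Bits n) ℂ) φ) ≤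
      Fintype.card (quadraticPhases n) * (2 * ((2 : ℝ) ^ n)⁻¹ * l2sq φ) := by
  set M : ℝ := Fintype.card (quadraticPhases n) * ((2 : ℝ) ^ n)⁻¹ with hM
  have hM0 : 0 ≤ M := by positivity
  have h1 : ((∑ g : quadraticPhases n, collisionWeight i j
      (tensorAct (hadamardPhase g.1 : Matrix (Bits n) (Bits n) ℂ) φ) : ℝ) : ℂ) =
      ∑ r, ∑ y, ∑ z, star (φ (y, r)) * φ (z, r) * ∑ g : quadraticPhases n,
        collisionKernel i j (hadamardPhase g.1 : Matrix (Bits n) (Bits n) ℂ) y z := by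
    rw [Complex.ofReal_sum]
    simp only [collisionWeight_tensorAct, Finset.mul_sum]
    rw [Finset.sum_comm]
    refine Finset.sum_congr rfl fun r _ => ?_
    rw [Finset.sum_comm]
    refine Finset.sum_congr rfl fun y _ => ?_
    rw [Finset.sum_comm]
  refine (le_abs_self _).trans ?_
  rw [← Real.norm_eq_abs, ← Complex.norm_real, h1]
  have hrow : ∀ r, ‖∑ y, ∑ z, star (φ (y, r)) * φ (z, r) * ∑ g : quadraticPhases n,
      collisionKernel i j (hadamardPhase g.1 : Matrix (Bits n) (Bits n) ℂ) y z‖ ≤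
      2 * M * l2sq fun y => φ (y, r) := by
    intro r
    calc _ ≤ ∑ y, (‖φ (y, r)‖ * ‖φ (y, r)‖ * M +
          ‖φ (y, r)‖ * ‖φ (y ∘ Equiv.swap i j, r)‖ * M) := by
          refine (norm_sum_le _ _).trans (Finset.sum_le_sum fun y _ => ?_)
          refine (norm_sum_le _ _).trans ?_
          calc _ ≤ ∑ z, ((if z = y then ‖φ (y, r)‖ * ‖φ (z, r)‖ * M else 0) +
                if z = y ∘ Equiv.swap i j then ‖φ (y, r)‖ * ‖φ (z, r)‖ * M else 0) := by
                refine Finset.sum_le_sum fun z _ => ?_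
                rw [norm_mul, norm_mul, norm_star]
                refine (mul_le_mul_of_nonneg_left (norm_sum_collisionKernel_le hij y z)
                  (by positivity)).trans ?_
                have hp : 0 ≤ ‖φ (y, r)‖ * ‖φ (z, r)‖ * M := by positivity
                rw [← hM]
                split_ifs <;> first | (exfalso; tauto) | linarith
            _ = _ := by
                rw [Finset.sum_add_distrib, Finset.sum_ite_eq', Finset.sum_ite_eq']
                simp
      _ ≤ _ := by
          rw [Finset.sum_add_distrib, ← Finset.sum_mul, ← Finset.sum_mul]
          have hs : ∑ y, ‖φ (y, r)‖ * ‖φ (y, r)‖ = l2sq fun y => φ (y, r) := by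
            simp only [l2sq, sq]
          have hs2 : ∑ y, ‖φ (y, r)‖ * ‖φ (y ∘ Equiv.swap i j, r)‖ ≤ l2sq fun y => φ (y, r) := by
            refine (sum_mul_le_sqrt_l2sq (fun y => φ (y, r))
              fun y => φ (y ∘ Equiv.swap i j, r)).trans (le_of_eq ?_)
            have h3 : (l2sq fun y : Fin t → Bits n => φ (y ∘ Equiv.swap i j, r)) =
                l2sq fun y => φ (y, r) :=
              (permuteTuple (Equiv.swap i j)).sum_comp fun y => ‖φ (y, r)‖ ^ 2
            rw [h3, Real.mul_self_sqrt (l2sq_nonneg _)]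
          rw [hs]
          nlinarith
  calc _ ≤ ∑ r, 2 * M * l2sq fun y => φ (y, r) :=
        (norm_sum_le _ _).trans (Finset.sum_le_sum fun r _ => hrow r)
    _ = _ := by
        rw [← Finset.mul_sum, ← l2sq_prod, hM]
        ring

end CliffordCollision

/-! ### Error estimates for Clifford-invariant laws. -/

section DesignBound

variable {n t : ℕ} {η : Type*}

theorem distinctPart_of_not_injective {ι : Type*} (φ : (Fin t → ι) × η → ℂ) (x : Fin t → ι) (r : η)
    (hx : ¬ Function.Injective x) : distinctPart φ (x, r) = 0 := if_neg hx

variable [Fintype η]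

theorem norm_sum_pmf_mul_le {α β : Type*} [Fintype α] [Fintype β] (p : PMF α) (q : PMF β)
    {z : α → β → ℂ} {B : ℝ} (hz : ∀ a b, ‖z a b‖ ≤ B) :
    ‖∑ a, ∑ b, ((p a).toReal * (q b).toReal : ℂ) * z a b‖ ≤ B := by
  calc _ ≤ ∑ a, ∑ b, (p a).toReal * (q b).toReal * B := by
        refine (norm_sum_le _ _).trans (Finset.sum_le_sum fun a _ => ?_)
        refine (norm_sum_le _ _).trans (Finset.sum_le_sum fun b _ => ?_)
        rw [norm_mul, norm_mul, Complex.norm_real, Complex.norm_real, Real.norm_of_nonneg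
          ENNReal.toReal_nonneg, Real.norm_of_nonneg ENNReal.toReal_nonneg]
        exact mul_le_mul_of_nonneg_left (hz a b) (by positivity)
    _ = B := by
        simp only [← Finset.sum_mul, ← Finset.mul_sum, PMF.sum_toReal_eq_one, one_mul, mul_one]

theorem l2sq_distinctPart_le {ι : Type*} [Fintype ι] (φ : (Fin t → ι) × η → ℂ) :
    l2sq (distinctPart φ) ≤ l2sq φ := by
  refine Finset.sum_le_sum fun p _ => ?_
  unfold distinctPart
  split_ifs
  · exact le_rfl
  · simp

/-- The three errors come from truncating `Uψ` to distinct tuples inside the form of `W`, from `D`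
being only approximately independent, and from restoring the truncated part inside `meanForm`. -/
theorem norm_pfMean_sub_meanForm_le {F : PMF (Bits n → ZMod 2)}
    (hF : IsTWiseIndependent (2 * t) F) (ht : 2 * t ≤ Fintype.card (Bits n))
    {D : PMF (Equiv.Perm (Bits n))} {δ : ℝ} (hδ : 0 ≤ δ) (hD : ∀ x y : Fin t ↪ Bits n,
      |permProb D x y - ((Fintype.card (Bits n)).descFactorial t : ℝ)⁻¹| ≤ δ)
    {W : Matrix ((Fin t → Bits n) × η) ((Fin t → Bits n) × η) ℂ} (hW : IsContraction W)
    {ψ : (Fin t → Bits n) × η → ℂ} (hψ : l2sq ψ = 1) (U : Matrix.unitaryGroup (Bits n) ℂ) :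
    ‖pfMean D F (fun R => sesq W (tensorAct (R : Matrix (Bits n) (Bits n) ℂ) ψ)
        (tensorAct (R : Matrix (Bits n) (Bits n) ℂ) ψ)) U - meanForm W ψ‖ ≤
      2 * √(l2sq (tensorAct (U : Matrix (Bits n) (Bits n) ℂ) ψ -
          distinctPart (tensorAct (U : Matrix (Bits n) (Bits n) ℂ) ψ))) +
        δ * (Fintype.card (Bits n)).descFactorial t * t.factorial +
        l2sq (tensorAct (U : Matrix (Bits n) (Bits n) ℂ) ψ -
          distinctPart (tensorAct (U : Matrix (Bits n) (Bits n) ℂ) ψ)) := by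
  set φ := tensorAct (U : Matrix (Bits n) (Bits n) ℂ) ψ with hφ
  set χ := distinctPart φ with hχ
  have hφ1 : l2sq φ = 1 := by rw [hφ, l2sq_tensorAct, hψ]
  have hχ1 : l2sq χ ≤ 1 := hφ1 ▸ l2sq_distinctPart_le φ
  set Y := ∑ π, ∑ f, ((D π).toReal * (F f).toReal : ℂ) *
    sesq W (tensorAct ((permOp π * phaseOp f : Matrix.unitaryGroup (Bits n) ℂ) :
      Matrix (Bits n) (Bits n) ℂ) χ)
      (tensorAct ((permOp π * phaseOp f : Matrix.unitaryGroup (Bits n) ℂ) :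
        Matrix (Bits n) (Bits n) ℂ) χ) with hY
  have h1 : ‖pfMean D F (fun R => sesq W (tensorAct (R : Matrix (Bits n) (Bits n) ℂ) ψ)
      (tensorAct (R : Matrix (Bits n) (Bits n) ℂ) ψ)) U - Y‖ ≤ 2 * √(l2sq (φ - χ)) := by
    simp only [pfMean, hY, ← Finset.sum_sub_distrib, ← mul_sub]
    refine norm_sum_pmf_mul_le D F fun π f => ?_
    rw [Matrix.UnitaryGroup.mul_val, tensorAct_mul, ← hφ]
    refine (norm_sesq_self_sub_le hW _ _ (by rw [l2sq_tensorAct, hφ1])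
      (by rw [l2sq_tensorAct]; exact hχ1)).trans (le_of_eq ?_)
    rw [← tensorAct_sub, l2sq_tensorAct]
  have h2 : ‖Y - meanForm W χ‖ ≤ δ * (Fintype.card (Bits n)).descFactorial t * t.factorial := by
    rw [hY, sum_pmf_sum_pmf_sesq_tensorAct hF ht D W (distinctPart_of_not_injective φ)]
    refine (norm_sum_blockForm_sub_meanForm_le hW (distinctPart_of_not_injective φ) hδ hD).trans ?_
    exact mul_le_of_le_one_right (by positivity) hχ1
  -- Unitary invariance replaces `ψ` by `Uψ`; this is where the dependence on `U` disappears.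
  have h3 : meanForm W ψ = meanForm W χ + meanForm W (φ - χ) := by
    rw [← meanForm_eq_add, hφ, meanForm_tensorAct]
  have h4 := norm_meanForm_le hW (φ - χ)
  rw [h3]
  set X := pfMean D F (fun R => sesq W (tensorAct (R : Matrix (Bits n) (Bits n) ℂ) ψ)
    (tensorAct (R : Matrix (Bits n) (Bits n) ℂ) ψ)) U
  calc ‖X - (meanForm W χ + meanForm W (φ - χ))‖
      = ‖(X - Y) + (Y - meanForm W χ) - meanForm W (φ - χ)‖ := by congr 1; ring
    _ ≤ ‖(X - Y) + (Y - meanForm W χ)‖ + ‖meanForm W (φ - χ)‖ := norm_sub_le _ _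
    _ ≤ _ := add_le_add ((norm_add_le _ _).trans (add_le_add h1 h2)) h4

/-- Left invariance of a measure under Clifford unitaries. -/
def IsCliffordInvariant (μ : Measure (Matrix.unitaryGroup (Bits n) ℂ)) : Prop :=
  ∀ V ∈ cliffordGroup n, ∀ h : Matrix.unitaryGroup (Bits n) ℂ → ℝ, Continuous h →
    ∫ U, h (V * U) ∂μ = ∫ U, h U ∂μ

theorem continuous_collisionWeight_tensorAct (i j : Fin t) (ψ : (Fin t → Bits n) × η → ℂ) :
    Continuous fun U : Matrix.unitaryGroup (Bits n) ℂ =>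
      collisionWeight i j (tensorAct (U : Matrix (Bits n) (Bits n) ℂ) ψ) := by
  unfold collisionWeight
  refine continuous_finsetSum _ fun p _ => ?_
  split_ifs
  · exact (((continuous_apply p).comp (continuous_tensorAct ψ)).norm).pow 2
  · exact continuous_const

/-- Invariance allows a random `hadamardPhase g` to be inserted before `U`; the average over `g` is
then bounded for each fixed `U`. -/
theorem integral_collisionWeight_le {μ : Measure (Matrix.unitaryGroup (Bits n) ℂ)}
    [IsProbabilityMeasure μ] (hμ : IsCliffordInvariant μ) {i j : Fin t} (hij : i ≠ j)
    (ψ : (Fin t → Bits n) × η → ℂ) :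
    ∫ U, collisionWeight i j (tensorAct (U : Matrix (Bits n) (Bits n) ℂ) ψ) ∂μ ≤
      2 * ((2 : ℝ) ^ n)⁻¹ * l2sq ψ := by
  classical
  let : Fintype (quadraticPhases n) := Fintype.ofFinite _
  obtain ⟨c, hc⟩ : ∃ c : ℝ, c = Fintype.card (quadraticPhases n) := ⟨_, rfl⟩
  have hc0 : 0 < c := by
    rw [hc]
    exact Nat.cast_pos.mpr Fintype.card_pos
  have hcont := continuous_collisionWeight_tensorAct i j ψ
  have h1 : c * ∫ U, collisionWeight i j (tensorAct (U : Matrix (Bits n) (Bits n) ℂ) ψ) ∂μ =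
      ∫ U : Matrix.unitaryGroup (Bits n) ℂ, ∑ g : quadraticPhases n, collisionWeight i j
        (tensorAct (hadamardPhase g.1 : Matrix (Bits n) (Bits n) ℂ)
          (tensorAct (U : Matrix (Bits n) (Bits n) ℂ) ψ)) ∂μ := by
    have h2 : ∀ g : quadraticPhases n, ∫ U : Matrix.unitaryGroup (Bits n) ℂ, collisionWeight i j
        (tensorAct (hadamardPhase g.1 : Matrix (Bits n) (Bits n) ℂ)
          (tensorAct (U : Matrix (Bits n) (Bits n) ℂ) ψ)) ∂μ =
        ∫ U, collisionWeight i j (tensorAct (U : Matrix (Bits n) (Bits n) ℂ) ψ) ∂μ := by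
      intro g
      rw [← hμ (hadamardPhase g.1) (mul_mem hadamardGate_mem_cliffordGroup
        (diagonalPhase_mem_cliffordGroup g.2)) _ hcont]
      simp only [Matrix.UnitaryGroup.mul_val, tensorAct_mul]
    rw [integral_finsetSum]
    · simp only [h2, Finset.sum_const, Finset.card_univ, nsmul_eq_mul, hc]
    · intro g _
      have h3 := integrable_of_continuous_unitaryGroup μ
        (hcont.comp (continuous_const_mul (hadamardPhase g.1)))
      simpa only [Function.comp_def, Matrix.UnitaryGroup.mul_val, tensorAct_mul] using h3
  refine le_of_mul_le_mul_left ?_ hc0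
  rw [h1]
  calc _ ≤ ∫ _U : Matrix.unitaryGroup (Bits n) ℂ, c * (2 * ((2 : ℝ) ^ n)⁻¹ * l2sq ψ) ∂μ := by
        refine integral_mono_of_nonneg (Filter.Eventually.of_forall fun U =>
          Finset.sum_nonneg fun g _ => collisionWeight_nonneg _ _ _) (integrable_const _)
          (Filter.Eventually.of_forall fun U => ?_)
        refine (sum_collisionWeight_hadamardPhase_le hij _).trans (le_of_eq ?_)
        rw [l2sq_tensorAct, hc]
    _ = _ := by simp

/-- The arithmetic-geometric mean inequality makes the square root linear in `x`, so only the mean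
of the collision weight is needed. For `s = 0` the quotient is `0`, hence the last hypothesis. -/
theorem two_mul_sqrt_le_div_add {x s : ℝ} (hx : 0 ≤ x) (hs : 0 ≤ s) (h : s = 0 → x = 0) :
    2 * √x ≤ x / s + s := by
  rcases hs.eq_or_lt with h0 | h0
  · simp [h h0.symm, ← h0]
  · have h1 : 0 ≤ (√x - s) ^ 2 / s := by positivity
    have h2 : (√x - s) ^ 2 / s = x / s + s - 2 * √x := by
      rw [sub_sq, Real.sq_sqrt hx]
      field_simp
      ring
    linarith

theorem norm_integral_pfMean_sub_meanForm_le {μ : Measure (Matrix.unitaryGroup (Bits n) ℂ)}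
    [IsProbabilityMeasure μ] (hμ : IsCliffordInvariant μ) {F : PMF (Bits n → ZMod 2)}
    (hF : IsTWiseIndependent (2 * t) F) (ht : 2 * t ≤ Fintype.card (Bits n))
    {D : PMF (Equiv.Perm (Bits n))} {δ : ℝ} (hδ : 0 ≤ δ) (hD : ∀ x y : Fin t ↪ Bits n,
      |permProb D x y - ((Fintype.card (Bits n)).descFactorial t : ℝ)⁻¹| ≤ δ)
    {W : Matrix ((Fin t → Bits n) × η) ((Fin t → Bits n) × η) ℂ} (hW : IsContraction W)
    {ψ : (Fin t → Bits n) × η → ℂ} (hψ : l2sq ψ = 1) (hs : t / √((2 : ℝ) ^ n) ≤ 1) :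
    ‖∫ U, pfMean D F (fun R => sesq W (tensorAct (R : Matrix (Bits n) (Bits n) ℂ) ψ)
        (tensorAct (R : Matrix (Bits n) (Bits n) ℂ) ψ)) U ∂μ - meanForm W ψ‖ ≤
      5 * (t / √((2 : ℝ) ^ n)) +
        δ * (Fintype.card (Bits n)).descFactorial t * t.factorial := by
  set s : ℝ := t / √((2 : ℝ) ^ n) with hs_def
  set ε := δ * (Fintype.card (Bits n)).descFactorial t * t.factorial with hε
  have hs0 : 0 ≤ s := by positivity
  have hs2 : s ^ 2 = (t : ℝ) ^ 2 * ((2 : ℝ) ^ n)⁻¹ := by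
    rw [hs_def, div_pow, Real.sq_sqrt (by positivity), div_eq_mul_inv]
  set Q : Matrix.unitaryGroup (Bits n) ℂ → ℝ := fun U => ∑ i : Fin t, ∑ j : Fin t,
    if i ≠ j then collisionWeight i j (tensorAct (U : Matrix (Bits n) (Bits n) ℂ) ψ) else 0 with hQ
  have hQ0 : ∀ U, 0 ≤ Q U := fun U => Finset.sum_nonneg fun i _ => Finset.sum_nonneg fun j _ => by
    split_ifs
    · exact collisionWeight_nonneg _ _ _
    · exact le_rfl
  have hQterm : ∀ i j : Fin t, Continuous fun U : Matrix.unitaryGroup (Bits n) ℂ =>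
      if i ≠ j then collisionWeight i j (tensorAct (U : Matrix (Bits n) (Bits n) ℂ) ψ) else 0 := by
    intro i j
    split_ifs
    · exact continuous_collisionWeight_tensorAct i j ψ
    · exact continuous_const
  have hQcont : Continuous Q :=
    continuous_finsetSum _ fun i _ => continuous_finsetSum _ fun j _ => hQterm i j
  have hQint : ∫ U, Q U ∂μ ≤ 2 * s ^ 2 := by
    have h1 : ∫ U, Q U ∂μ = ∑ i : Fin t, ∑ j : Fin t, ∫ U : Matrix.unitaryGroup (Bits n) ℂ,
        (if i ≠ j then collisionWeight i j (tensorAct (U : Matrix (Bits n) (Bits n) ℂ) ψ)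
          else 0) ∂μ := by
      rw [integral_finsetSum _ fun i _ => integrable_of_continuous_unitaryGroup μ
        (continuous_finsetSum _ fun j _ => hQterm i j)]
      exact Finset.sum_congr rfl fun i _ => integral_finsetSum _ fun j _ =>
        integrable_of_continuous_unitaryGroup μ (hQterm i j)
    calc ∫ U, Q U ∂μ ≤ ∑ _i : Fin t, ∑ _j : Fin t, 2 * ((2 : ℝ) ^ n)⁻¹ := by
          rw [h1]
          refine Finset.sum_le_sum fun i _ => Finset.sum_le_sum fun j _ => ?_
          split_ifs with hij
          · simpa only [hψ, mul_one] using integral_collisionWeight_le hμ hij ψ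
          · rw [integral_zero]
            positivity
      _ = 2 * s ^ 2 := by
          simp only [Finset.sum_const, Finset.card_univ, Fintype.card_fin, nsmul_eq_mul, hs2]
          ring
  have hcont : Continuous fun U => pfMean D F (fun R => sesq W
      (tensorAct (R : Matrix (Bits n) (Bits n) ℂ) ψ)
      (tensorAct (R : Matrix (Bits n) (Bits n) ℂ) ψ)) U := by
    have h : Continuous fun R : Matrix.unitaryGroup (Bits n) ℂ => sesq W
        (tensorAct (R : Matrix (Bits n) (Bits n) ℂ) ψ)
        (tensorAct (R : Matrix (Bits n) (Bits n) ℂ) ψ) :=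
      continuous_sesq W (continuous_tensorAct ψ) (continuous_tensorAct ψ)
    exact continuous_finsetSum _ fun π _ => continuous_finsetSum _ fun f _ =>
      continuous_const.mul (h.comp (continuous_const_mul (permOp π * phaseOp f)))
  have hpoint : ∀ U, ‖pfMean D F (fun R => sesq W (tensorAct (R : Matrix (Bits n) (Bits n) ℂ) ψ)
      (tensorAct (R : Matrix (Bits n) (Bits n) ℂ) ψ)) U - meanForm W ψ‖ ≤
      Q U / s + s + ε + Q U := by
    intro U
    refine (norm_pfMean_sub_meanForm_le hF ht hδ hD hW hψ U).trans ?_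
    have h1 := l2sq_sub_distinctPart_le (tensorAct (U : Matrix (Bits n) (Bits n) ℂ) ψ)
    have h2 : 2 * √(Q U) ≤ Q U / s + s := by
      refine two_mul_sqrt_le_div_add (hQ0 U) hs0 fun h0 => ?_
      -- With no positions there are no collisions, so `Q` vanishes.
      have ht0 : t = 0 := by
        rw [hs_def, div_eq_zero_iff] at h0
        rcases h0 with h0 | h0
        · exact_mod_cast h0
        · exact absurd h0 (by positivity)
      subst ht0
      simp [hQ]
    have h3 := Real.sqrt_le_sqrt h1
    linarith
  have hconst : meanForm W ψ = ∫ _U : Matrix.unitaryGroup (Bits n) ℂ, meanForm W ψ ∂μ := by simp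
  have hQi : Integrable Q μ := integrable_of_continuous_unitaryGroup μ hQcont
  rw [hconst, ← integral_sub (integrable_of_continuous_unitaryGroup μ hcont) (integrable_const _)]
  calc _ ≤ ∫ U, (Q U / s + s + ε + Q U) ∂μ :=
        norm_integral_le_of_norm_le ((((hQi.div_const s).add (integrable_const s)).add
          (integrable_const ε)).add hQi) (Filter.Eventually.of_forall hpoint)
    _ = (∫ U, Q U ∂μ) / s + s + ε + ∫ U, Q U ∂μ := by
        have h1 : ∀ U, Q U / s + s + ε + Q U = Q U * (s⁻¹ + 1) + (s + ε) := fun U => by ring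
        simp only [h1]
        rw [integral_add (hQi.mul_const _) (integrable_const _), integral_mul_const, integral_const,
          probReal_univ, one_smul]
        ring
    _ ≤ 2 * s ^ 2 / s + s + ε + 2 * s ^ 2 := by gcongr
    -- The terms are `2s`, `s` and `2s²`, the last at most `2s` because `s ≤ 1`.
    _ ≤ 5 * s + ε := by
        have h1 : 2 * s ^ 2 / s = 2 * s := by
          rcases hs0.eq_or_lt with h0 | h0
          · simp [← h0]
          · field_simp
        rw [h1]
        nlinarith

theorem isCliffordInvariant_cliffordLaw (n : ℕ) : IsCliffordInvariant (cliffordLaw n) :=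
  fun _ hV _ hh => integral_cliffordLaw_mul_left hV hh

theorem isCliffordInvariant_haarProb (n : ℕ) :
    IsCliffordInvariant (haarProb (Matrix.unitaryGroup (Bits n) ℂ)) :=
  fun V _ h _ => integral_mul_left_eq_self h V

theorem card_bits (n : ℕ) : Fintype.card (Bits n) = 2 ^ n := by simp

theorem approximation_error_le {K₀ δ : ℝ} (ht : t ≤ 2 ^ n)
    (hδ : δ ≤ K₀ * (t / ((2 : ℝ) ^ n) ^ (4 * (t : ℝ) + 1 / 2))) :
    max δ 0 * ((2 ^ n).descFactorial t : ℕ) * t.factorial ≤ |K₀| * (t / √((2 : ℝ) ^ n)) := by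
  set d : ℝ := (2 : ℝ) ^ n with hd
  have hd1 : 1 ≤ d := one_le_pow₀ one_le_two
  have hd0 : 0 < d := by positivity
  have hpow : d ^ (4 * (t : ℝ) + 1 / 2) = d ^ (4 * t) * √d := by
    rw [Real.rpow_add hd0, ← Real.sqrt_eq_rpow, ← Real.rpow_natCast]
    push_cast
    rfl
  have h1 : max δ 0 ≤ |K₀| * (t / (d ^ (4 * t) * √d)) := by
    rw [hpow] at hδ
    refine max_le (hδ.trans (mul_le_mul_of_nonneg_right (le_abs_self _) (by positivity)))
      (by positivity)
  have h2 : (((2 ^ n).descFactorial t : ℕ) : ℝ) ≤ d ^ t := by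
    rw [hd]
    exact_mod_cast Nat.descFactorial_le_pow (2 ^ n) t
  have h3 : (t.factorial : ℝ) ≤ d ^ t := by
    rw [hd]
    exact_mod_cast (Nat.factorial_le_pow t).trans (Nat.pow_le_pow_left ht t)
  -- The falling factorial and `t!` each cost at most `d^t`, so `d^{2t}` of the available `d^{4t}`
  -- suffices.
  calc max δ 0 * ((2 ^ n).descFactorial t : ℕ) * t.factorial
      ≤ |K₀| * (t / (d ^ (4 * t) * √d)) * d ^ t * d ^ t := by gcongr
    _ = |K₀| * (t / √d) * (d ^ (2 * t) / d ^ (4 * t)) := by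
        rw [show 2 * t = t + t by ring, pow_add]
        field_simp
    _ ≤ |K₀| * (t / √d) := by
        refine mul_le_of_le_one_right (by positivity) ?_
        exact div_le_one_of_le₀ (pow_le_pow_right₀ hd1 (by omega)) (by positivity)

end DesignBound
end

/-! ### Assembly of the design bound. -/

theorem mainTheorem2 (K₀ : ℝ) :
    ∃ K : ℝ, 0 < K ∧
      ∀ (n t : ℕ) (F : PMF (Bits n → ZMod 2)) (D : PMF (Equiv.Perm (Bits n))) (δ : ℝ),
        δ ≤ K₀ * (t / ((2 : ℝ) ^ n) ^ (4 * (t : ℝ) + 1 / 2)) →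
        IsTWiseIndependent (2 * t) F →
        IsApproxTWiseIndependentPerm t δ D →
        IsDiamondApproxDesign (pfcEnsemble n D F) t (K * (t / √((2 : ℝ) ^ n))) := by
  -- Both the Clifford and the Haar average lie within `(5 + |K₀|) t / √d` of `meanForm W ψ`.
  refine ⟨2 * (5 + |K₀|), by positivity, fun n t F D δ hδ hF hD => ?_⟩
  refine iSup₂_le fun ψ hψ => ENNReal.ofReal_le_ofReal ?_
  have hψ1 : l2sq (ψ : (Fin t → Bits n) × (Fin t → Bits n) → ℂ) = 1 := by
    rw [l2sq, ← EuclideanSpace.norm_sq_eq, hψ, one_pow]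
  obtain ⟨W, hW, htr⟩ := exists_contraction_trace_eq_traceNorm
    (extendById (twirl (pfcEnsemble n D F) t) (proj ψ) -
      extendById (twirl (haarProb (Matrix.unitaryGroup (Bits n) ℂ)) t) (proj ψ))
  have hcont : Continuous fun R : Matrix.unitaryGroup (Bits n) ℂ => sesq W
      (tensorAct (R : Matrix (Bits n) (Bits n) ℂ) ψ)
      (tensorAct (R : Matrix (Bits n) (Bits n) ℂ) ψ) :=
    continuous_sesq W (continuous_tensorAct _) (continuous_tensorAct _)
  rw [Matrix.mul_sub, Matrix.trace_sub, trace_mul_extendById_twirl, trace_mul_extendById_twirl,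
    integral_pfcEnsemble D F hcont, integral_haarProb_eq_integral_pfMean D F hcont] at htr
  have hle : traceNorm (extendById (twirl (pfcEnsemble n D F) t) (proj ψ) -
      extendById (twirl (haarProb (Matrix.unitaryGroup (Bits n) ℂ)) t) (proj ψ)) ≤
      ‖∫ U, pfMean D F (fun R => sesq W (tensorAct (R : Matrix (Bits n) (Bits n) ℂ) ψ)
          (tensorAct (R : Matrix (Bits n) (Bits n) ℂ) ψ)) U ∂cliffordLaw n -
        ∫ U, pfMean D F (fun R => sesq W (tensorAct (R : Matrix (Bits n) (Bits n) ℂ) ψ)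
          (tensorAct (R : Matrix (Bits n) (Bits n) ℂ) ψ)) U
          ∂haarProb (Matrix.unitaryGroup (Bits n) ℂ)‖ := by
    rw [← htr, Complex.norm_real]
    exact le_abs_self _
  refine hle.trans ?_
  have hs0 : 0 ≤ t / √((2 : ℝ) ^ n) := by positivity
  -- If `t ≥ √d`, the trivial bound `2` on the difference is enough.
  rcases le_or_gt 1 (t / √((2 : ℝ) ^ n)) with hs | hs
  · have hone : ∀ U : Matrix.unitaryGroup (Bits n) ℂ, ‖pfMean D F (fun R => sesq W
        (tensorAct (R : Matrix (Bits n) (Bits n) ℂ) ψ)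
        (tensorAct (R : Matrix (Bits n) (Bits n) ℂ) ψ)) U‖ ≤ 1 := fun U =>
      norm_sum_pmf_mul_le D F fun π f => by
        refine (hW _ _).trans ?_
        rw [l2sq_tensorAct, hψ1, Real.sqrt_one, one_mul]
    have h1 := norm_integral_le_of_norm_le_const (μ := cliffordLaw n)
      (Filter.Eventually.of_forall hone)
    have h2 := norm_integral_le_of_norm_le_const
      (μ := haarProb (Matrix.unitaryGroup (Bits n) ℂ)) (Filter.Eventually.of_forall hone)
    simp only [probReal_univ, mul_one] at h1 h2
    refine (norm_sub_le _ _).trans ?_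
    nlinarith [abs_nonneg K₀]
  · have hsq : (t : ℝ) ^ 2 < 2 ^ n := by
      rw [div_lt_one (by positivity)] at hs
      exact (Real.lt_sqrt (by positivity)).mp hs
    have hsqN : t ^ 2 < 2 ^ n := by exact_mod_cast hsq
    -- For `t ≥ 2` this follows from `2t ≤ t²`. For `t = 1` the strict inequality excludes `n = 0`.
    have ht : 2 * t ≤ 2 ^ n := by
      rcases Nat.lt_or_ge t 2 with h | h
      · interval_cases t
        · simp
        · have hn : n ≠ 0 := by
            rintro rfl
            simp at hsqN
          calc 2 * 1 = 2 ^ 1 := rfl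
            _ ≤ 2 ^ n := Nat.pow_le_pow_right two_pos (Nat.one_le_iff_ne_zero.mpr hn)
      · nlinarith
    have hcard := card_bits n
    -- Passing to `max δ 0` supplies the nonnegativity that the error estimates ask for.
    have hD' : ∀ x y : Fin t ↪ Bits n,
        |permProb D x y - ((Fintype.card (Bits n)).descFactorial t : ℝ)⁻¹| ≤ max δ 0 :=
      fun x y => (hD x y x.injective y.injective).trans (le_max_left _ _)
    have h1 := norm_integral_pfMean_sub_meanForm_le (isCliffordInvariant_cliffordLaw n) hF
      (hcard ▸ ht) (le_max_right δ 0) hD' hW hψ1 hs.le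
    have h2 := norm_integral_pfMean_sub_meanForm_le (isCliffordInvariant_haarProb n) hF
      (hcard ▸ ht) (le_max_right δ 0) hD' hW hψ1 hs.le
    have h3 := approximation_error_le (n := n) (t := t) (by omega) hδ
    rw [hcard] at h1 h2
    rw [← sub_sub_sub_cancel_right _ _ (meanForm W ψ)]
    refine (norm_sub_le _ _).trans ?_
    linarith
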